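/- Let $k$ be a field and $n\ge 0$ an integer, and write $[n]=\{1,\dots,n\}$. Let $Q_n$ be the associative unital $k$-algebra with generators $u(A)$, $\emptyset\ne A\subseteq[n]$, and relations $$\sum_{C,D\subseteq A}[u(C\cup\{i\}),u(D\cup\{j\})]=\Big(\sum_{E\subseteq A}u(E\cup\{i,j\})\Big)\sum_{F\subseteq A}\big(u(F\cup\{i\})-u(F\cup\{j\})\big)$$ for all $A\subseteq[n]$ and all distinct $i,j\in[n]\setminus A$. Let $P_n$ be the quotient of $Q_n$ by the two-sided ideal generated by all $u(A)$ with $A$ not in the complex $\{\{1\},\dots,\{n\},\{1,2\},\{2,3\},\dots,\{n-1,n\}\}$ of the path graph on $n$ vertices, and let $V\subseteq P_n$ be the span of the images of the generators $u(A)$. Let $R\subseteq V\otimes V$ be the kernel of the multiplication map $V\otimes V\to P_n$. Then $P_n$ is a Koszul algebra. That is: 1. $P_n$ is quadratic: the canonical map $T(V)\to P_n$ from the tensor algebra is surjective and its kernel is the two-sided ideal generated by $R$. 2. For every $m\ge 0$, the subspaces $V^{\otimes a}\otimes R\otimes V^{\otimes b}$ with $a,b\ge 0$, $a+2+b=m$,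 generate a distributive sublattice of the lattice of subspaces of $V^{\otimes m}$. -/

import Mathlib

/-! ## Quadratic and Koszul algebras -/

section Koszul

variable {k : Type*} [Field k] {A : Type*} [Ring A] [Algebra k A]

/-- The canonical algebra map `T(V) → A` for a subspace `V` of an algebra `A`. -/
noncomputable def tensorEval (V : Submodule k A) : TensorAlgebra k V →ₐ[k] A :=
  TensorAlgebra.lift k V.subtype

/-- The tensor power `V^{⊗ m}`, as the degree `m` component of the tensor algebra `T(V)`. -/
noncomputable def tensorPiece (V : Submodule k A) (m : ℕ) :
    Submodule k (TensorAlgebra k V) :=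
  LinearMap.range (TensorAlgebra.ι k : V →ₗ[k] TensorAlgebra k V) ^ m

/-- The space `R ⊆ V ⊗ V` of quadratic relations: the kernel of the multiplication map
`V ⊗ V → A`. -/
noncomputable def quadRelations (V : Submodule k A) : Submodule k (TensorAlgebra k V) :=
  tensorPiece V 2 ⊓ LinearMap.ker (tensorEval V).toLinearMap

/-- `A` is a quadratic algebra with space of generators `V`: the map `T(V) → A` is onto, and its
kernel is the two-sided ideal generated by `R ⊆ V ⊗ V`.  That is, `A = T(V) / (R)`. -/
structure IsQuadraticAlgebra (V : Submodule k A) : Prop where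
  surjective : Function.Surjective (tensorEval V)
  ker_eq : TwoSidedIdeal.ker (tensorEval V) =
    TwoSidedIdeal.span (quadRelations V : Set (TensorAlgebra k V))

/-- The `m - 1` subspaces `V^{⊗ a} ⊗ R ⊗ V^{⊗ b}`, `a + 2 + b = m`, of `V^{⊗ m}`. -/
def relationSubspaces (V : Submodule k A) (m : ℕ) : Set (Submodule k (TensorAlgebra k V)) :=
  {W | ∃ a b : ℕ, a + 2 + b = m ∧ W = tensorPiece V a * quadRelations V * tensorPiece V b}

/-- A set of elements of a lattice generates a distributive sublattice. -/
def GeneratesDistributive {L : Type*} [Lattice L] (S : Set L) : Prop :=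
  ∀ x ∈ latticeClosure S, ∀ y ∈ latticeClosure S, ∀ z ∈ latticeClosure S,
    x ⊓ (y ⊔ z) = (x ⊓ y) ⊔ (x ⊓ z)

/-- `A` is a Koszul algebra with space of generators `V`: it is quadratic, and for every `m` the
subspaces `V^{⊗ a} ⊗ R ⊗ V^{⊗ b}` generate a distributive lattice of subspaces of `V^{⊗ m}`. -/
structure IsKoszulAlgebra (V : Submodule k A) : Prop where
  quadratic : IsQuadraticAlgebra V
  distributive : ∀ m : ℕ, GeneratesDistributive (relationSubspaces V m)

end Koszul

/-! ## The algebra of pseudo-roots and its quotients -/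

/-- The index set of the generators `u(A)` : nonempty subsets `A` of the set of `n` nodes. -/
abbrev NodeSet (n : ℕ) : Type := {A : Finset (Fin n) // A.Nonempty}

/-- The free generator `u(C ∪ {i})`. -/
noncomputable def freeU (k : Type*) [Field k] {n : ℕ} (i : Fin n) (C : Finset (Fin n)) :
    FreeAlgebra k (NodeSet n) :=
  FreeAlgebra.ι k ⟨insert i C, Finset.insert_nonempty i C⟩

/-- The defining relations of `Q_n` : for `A ⊆ [n]` and distinct `i, j ∉ A`,
`∑_{C, D ⊆ A} [u(C ∪ i), u(D ∪ j)] = (∑_{E ⊆ A} u(E ∪ i ∪ j)) ∑_{F ⊆ A} (u(F ∪ i) - u(F ∪ j))`. -/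
inductive QRel (k : Type*) [Field k] (n : ℕ) :
    FreeAlgebra k (NodeSet n) → FreeAlgebra k (NodeSet n) → Prop
  | rel (A : Finset (Fin n)) (i j : Fin n) (hi : i ∉ A) (hj : j ∉ A) (hij : i ≠ j) :
    QRel k n
      (∑ C ∈ A.powerset, ∑ D ∈ A.powerset,
        (freeU k i C * freeU k j D - freeU k j D * freeU k i C))
      ((∑ E ∈ A.powerset, freeU k i (insert j E)) *
        ∑ F ∈ A.powerset, (freeU k i F - freeU k j F))

/-- The algebra `Q_n` of all pseudo-roots of a generic noncommutative polynomial of degree `n`. -/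
abbrev QAlg (k : Type*) [Field k] (n : ℕ) : Type _ := RingQuot (QRel k n)

/-- The generator `u(A)` of `Q_n`. -/
noncomputable def QAlg.u (k : Type*) [Field k] {n : ℕ} (A : NodeSet n) : QAlg k n :=
  RingQuot.mkAlgHom k (QRel k n) (FreeAlgebra.ι k A)

/-- A complex with `n` nodes: a family of nonempty subsets of `[n]`, closed under passing to
nonempty subsets. -/
structure NodeComplex (n : ℕ) where
  faces : Set (Finset (Fin n))
  nonempty_of_mem : ∀ A ∈ faces, A.Nonempty
  down_closed : ∀ A ∈ faces, ∀ B : Finset (Fin n), B ⊆ A → B.Nonempty → B ∈ faces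

/-- The relations `u(A) = 0` for `A ∉ F`. -/
inductive ComplexRel (k : Type*) [Field k] {n : ℕ} (F : NodeComplex n) :
    QAlg k n → QAlg k n → Prop
  | rel (A : NodeSet n) (hA : A.1 ∉ F.faces) : ComplexRel k F (QAlg.u k A) 0

/-- The algebra `Q_n(F)`: the quotient of `Q_n` by the ideal generated by the `u(A)`, `A ∉ F`. -/
abbrev QComplex (k : Type*) [Field k] {n : ℕ} (F : NodeComplex n) : Type _ :=
  RingQuot (ComplexRel k F)

/-- The image of the generator `u(A)` in `Q_n(F)`. -/
noncomputable def QComplex.u (k : Type*) [Field k] {n : ℕ} (F : NodeComplex n) (A : NodeSet n) :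
    QComplex k F :=
  RingQuot.mkAlgHom k (ComplexRel k F) (QAlg.u k A)

/-- The span of the generators `u(A)` in `Q_n(F)`. -/
noncomputable def QComplex.generatorSpan (k : Type*) [Field k] {n : ℕ} (F : NodeComplex n) :
    Submodule k (QComplex k F) :=
  Submodule.span k (Set.range (QComplex.u k F))

/-- The complex of a graph on `n` vertices: all one-vertex sets, and the edges. -/
def graphComplex {n : ℕ} (G : SimpleGraph (Fin n)) : NodeComplex n where
  faces := {A | (∃ i, A = {i}) ∨ ∃ i j, G.Adj i j ∧ A = {i, j}}
  nonempty_of_mem := by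
    rintro A (⟨i, rfl⟩ | ⟨i, j, -, rfl⟩)
    · exact Finset.singleton_nonempty i
    · exact Finset.insert_nonempty i {j}
  down_closed := by
    rintro A (⟨i, rfl⟩ | ⟨i, j, h, rfl⟩) B hB hne
    · exact Or.inl ⟨i, (Finset.Nonempty.subset_singleton_iff hne).1 hB⟩
    · by_cases hi : i ∈ B
      · by_cases hj : j ∈ B
        · refine Or.inr ⟨i, j, h, Finset.Subset.antisymm hB ?_⟩
          intro x hx
          rcases Finset.mem_insert.1 hx with rfl | hx
          · exact hi
          · rwa [Finset.mem_singleton.1 hx]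
        · refine Or.inl ⟨i, (Finset.Nonempty.subset_singleton_iff hne).1 fun x hx => ?_⟩
          rcases Finset.mem_insert.1 (hB hx) with rfl | hx'
          · exact Finset.mem_singleton_self _
          · exact absurd (Finset.mem_singleton.1 hx' ▸ hx) hj
      · refine Or.inl ⟨j, (Finset.Nonempty.subset_singleton_iff hne).1 fun x hx => ?_⟩
        rcases Finset.mem_insert.1 (hB hx) with rfl | hx'
        · exact absurd hx hi
        · exact hx'

/-- The complex of the path on `n` vertices, with faces `{1}, …, {n}, {1, 2}, …, {n - 1, n}`
(the nodes are numbered from `0` here). -/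
def pathComplex (n : ℕ) : NodeComplex n := graphComplex (SimpleGraph.pathGraph n)

/-! ## Words in the generators of the path algebra

The generators `u({i})` and `u({i, i + 1})` are numbered `2 * i` and `2 * i + 1`.  The generator
number `a` thus belongs to the interval of nodes from `a / 2` to `(a + 1) / 2`. -/

namespace PathKoszul

/-! With `x`, `y`, `z` the sums of `u(C ∪ i)`, `u(D ∪ j)`, `u(E ∪ i ∪ j)`, a defining relation reads
`(x + z) y = (y + z) x`: two nodes may be removed from a set in either order. In the path algebra,
inclusion-exclusion turns these relations into one `rel a b` for each pair of disjoint intervals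
with `a` left of `b`, and its lexicographically least word is `a b`. Lying to the left is
transitive, so a word reducible at every position is a family of pairwise disjoint intervals.

For such a family, take the signed sum, over all orders of removing its intervals, of the products
of pseudo-roots (`koszulElement`). Its least word lists the family from left to right. It lies in
every `V^a R V^b`, because exchanging two consecutive removals produces a bracket in `R`
(`pseudoRoot_bracket_mem`).

An arbitrary word splits into maximal runs of this kind. The product of the Koszul elements of the
runs has that word as least word and lies in `V^a R V^b` for every position `a` at which the word is
reducible (`exists_distributing`). By triangularity these products form a basis of `V^{⊗ m}`. A
dimension count shows that each `V^a R V^b` is spanned by a part of it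
(`exists_distributing_family`), which gives distributivity. Quadraticity holds because all
relations, read in `T(V)`, have degree 2. -/

/-- The interval of `a` lies to the left of the interval of `b`. -/
def Precedes (a b : ℕ) : Prop := (a + 1) / 2 < b / 2

/-! ### Quadratic relations between pseudo-roots. -/

section Abstract

variable {k : Type*} [Field k] {T : Type*} [Ring T] [Algebra k T] (g : ℕ → T)

/-- The generator of an interval `s`, modified by the edges joining the node `s` to the
left (if `p`) or to the right (if `q`). -/
def modified (p q : Prop) [Decidable p] [Decidable q] (s : ℕ) : T :=
  g s + (if p then g (s - 1) else 0) + (if q then g (s + 1) else 0)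

/-- `s` is a single node, and its left neighbour is covered by `S`. -/
def LeftCovered (S : Finset ℕ) (s : ℕ) : Prop := s % 2 = 0 ∧ ∃ t ∈ S, t + 2 = s ∨ t + 3 = s

/-- `s` is a single node, and its right neighbour is covered by `S`. -/
def RightCovered (S : Finset ℕ) (s : ℕ) : Prop := s % 2 = 0 ∧ ∃ t ∈ S, s + 2 = t ∨ s + 3 = t

instance (S : Finset ℕ) (s : ℕ) : Decidable (LeftCovered S s) :=
  inferInstanceAs (Decidable (_ ∧ _))

instance (S : Finset ℕ) (s : ℕ) : Decidable (RightCovered S s) :=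
  inferInstanceAs (Decidable (_ ∧ _))

/-- The pseudo-root obtained by removing `s` from the family of intervals `S`. -/
def pseudoRoot (S : Finset ℕ) (s : ℕ) : T := modified g (LeftCovered S s) (RightCovered S s) s

/-- The quadratic relation with leading term `g a * g b`. -/
def rel (a b : ℕ) : T := pseudoRoot g {b} a * g b - pseudoRoot g {a} b * g a

variable (k) in
/-- The span of the quadratic relations. -/
def relSpace : Submodule k T := Submodule.span k {x | ∃ a b, Precedes a b ∧ x = rel g a b}

variable {g}

theorem rel_mem {a b : ℕ} (h : Precedes a b) : rel g a b ∈ relSpace k g :=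
  Submodule.subset_span ⟨a, b, h, rfl⟩

/-- Only a single node is ever modified, and only by an edge to a covered neighbour. Intervals that
are not adjacent, or that are both edges, therefore leave each other unmodified. -/
theorem rel_eq_commutator {a b : ℕ} (h : Precedes a b)
    (h' : (a + 1) / 2 + 1 ≠ b / 2 ∨ (a % 2 = 1 ∧ b % 2 = 1)) :
    rel g a b = g a * g b - g b * g a := by
  unfold Precedes at h
  have h1 : ¬ RightCovered {b} a := by simp [RightCovered]; omega
  have h2 : ¬ LeftCovered {a} b := by simp [LeftCovered]; omega
  have h3 : ¬ LeftCovered {b} a := by simp [LeftCovered]; omega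
  have h4 : ¬ RightCovered {a} b := by simp [RightCovered]; omega
  simp [rel, pseudoRoot, modified, h1, h2, h3, h4]

theorem rel_eq_adjacent {a b : ℕ} (h' : (a + 1) / 2 + 1 = b / 2) :
    rel g a b = (g a + if a % 2 = 0 then g (a + 1) else 0) * g b -
      (g b + if b % 2 = 0 then g (b - 1) else 0) * g a := by
  have h1 : RightCovered {b} a ↔ a % 2 = 0 := by simp [RightCovered]; omega
  have h2 : LeftCovered {a} b ↔ b % 2 = 0 := by simp [LeftCovered]; omega
  have h3 : ¬ LeftCovered {b} a := by simp [LeftCovered]; omega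
  have h4 : ¬ RightCovered {a} b := by simp [RightCovered]; omega
  simp [rel, pseudoRoot, modified, h1, h2, h3, h4]

theorem commutator_mem {a b : ℕ} (h : Precedes a b)
    (h' : (a + 1) / 2 + 1 ≠ b / 2 ∨ (a % 2 = 1 ∧ b % 2 = 1)) :
    g a * g b - g b * g a ∈ relSpace k g :=
  rel_eq_commutator (g := g) h h' ▸ rel_mem h

theorem commutator_add_left {M : Submodule k T} {x x' y : T} (h : x * y - y * x ∈ M)
    (h' : x' * y - y * x' ∈ M) : (x + x') * y - y * (x + x') ∈ M := by
  convert M.add_mem h h' using 1; noncomm_ring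

theorem commutator_add_right {M : Submodule k T} {x y y' : T} (h : x * y - y * x ∈ M)
    (h' : x * y' - y' * x ∈ M) : x * (y + y') - (y + y') * x ∈ M := by
  convert M.add_mem h h' using 1; noncomm_ring

theorem commutator_ite_left {M : Submodule k T} {p : Prop} [Decidable p] {x y : T}
    (h : p → x * y - y * x ∈ M) : (if p then x else 0) * y - y * (if p then x else 0) ∈ M := by
  split_ifs with hp
  · exact h hp
  · simp

theorem commutator_ite_right {M : Submodule k T} {p : Prop} [Decidable p] {x y : T}
    (h : p → x * y - y * x ∈ M) : x * (if p then y else 0) - (if p then y else 0) * x ∈ M := by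
  split_ifs with hp
  · exact h hp
  · simp

/-- Pseudo-roots of intervals that are far apart commute. -/
theorem modified_far_mem {s t : ℕ} {p q p' q' : Prop} [Decidable p] [Decidable q] [Decidable p']
    [Decidable q'] (hst : (s + 1) / 2 + 1 < t / 2)
    (hp : p → s % 2 = 0 ∧ 2 ≤ s) (hq : q → s % 2 = 0) (hp' : p' → t % 2 = 0)
    (hq' : q' → t % 2 = 0) (hfar : s % 2 = 0 → t % 2 = 0 → s + 4 ≠ t) :
    modified g p q s * modified g p' q' t - modified g p' q' t * modified g p q s ∈
      relSpace k g := by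
  unfold modified
  -- Nine commutators of letters. Modification adds edges reaching one node further, so every pair
  -- is still separated by a node or consists of two disjoint edges; the exception, two nodes one
  -- node apart, is excluded by `hfar`.
  refine commutator_add_left (commutator_add_left ?_ (commutator_ite_left fun h => ?_))
    (commutator_ite_left fun h => ?_) <;>
  refine commutator_add_right (commutator_add_right ?_ (commutator_ite_right fun h => ?_))
    (commutator_ite_right fun h => ?_) <;>
  refine commutator_mem (show (_ + 1) / 2 < _ / 2 from ?_) ?_ <;> grind

/-- Pseudo-roots of two nodes with one node between them commute. -/
theorem modified_gap_mem {s t : ℕ} {p q p' q' : Prop} [Decidable p] [Decidable q] [Decidable p']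
    [Decidable q'] (hs : s % 2 = 0) (hst : t = s + 4) (hp : p → 2 ≤ s) (hqp : q ↔ p') :
    modified g p q s * modified g p' q' t - modified g p' q' t * modified g p q s ∈
      relSpace k g := by
  subst hst
  -- The edges `s + 1` and `s + 3` share the middle node, so their commutator alone is no relation.
  -- Its two halves come from `rel g s (s + 3)` and `rel g (s + 1) (s + 4)`, which is why both edges
  -- must occur together.
  have key : (g s + if q then g (s + 1) else 0) * (g (s + 4) + if p' then g (s + 4 - 1) else 0) -
      (g (s + 4) + if p' then g (s + 4 - 1) else 0) * (g s + if q then g (s + 1) else 0) ∈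
      relSpace k g := by
    have h0 : g s * g (s + 4) - g (s + 4) * g s ∈ relSpace k g :=
      commutator_mem (by unfold Precedes; omega) (by omega)
    by_cases h : q
    · have h1 := rel_mem (k := k) (g := g) (a := s) (b := s + 3) (by unfold Precedes; omega)
      have h2 := rel_mem (k := k) (g := g) (a := s + 1) (b := s + 4) (by unfold Precedes; omega)
      rw [rel_eq_adjacent (by omega), if_pos (by omega), if_neg (by omega)] at h1
      rw [rel_eq_adjacent (by omega), if_neg (by omega), if_pos (by omega)] at h2
      simp only [← hqp, h, if_true, show s + 4 - 1 = s + 3 by omega] at h1 h2 ⊢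
      convert add_mem h0 (add_mem h1 h2) using 1
      noncomm_ring
    · simpa [← hqp, h] using h0
  have e1 : modified g p q s = (if p then g (s - 1) else 0) +
      (g s + if q then g (s + 1) else 0) := by unfold modified; abel
  rw [e1]
  refine commutator_add_left (commutator_ite_left fun h => ?_) ?_
  · unfold modified
    refine commutator_add_right (commutator_add_right ?_ (commutator_ite_right fun _ => ?_))
      (commutator_ite_right fun _ => ?_) <;>
    refine commutator_mem (show (_ + 1) / 2 < _ / 2 from ?_) ?_ <;> grind
  · refine commutator_add_right key (commutator_ite_right fun _ => ?_)
    refine commutator_add_left ?_ (commutator_ite_left fun _ => ?_) <;>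
    refine commutator_mem (show (_ + 1) / 2 < _ / 2 from ?_) ?_ <;> grind

/-- The quadratic relation between pseudo-roots of adjacent intervals. -/
theorem modified_adjacent_mem {s t : ℕ} {p q p' q' : Prop} [Decidable p] [Decidable q]
    [Decidable p'] [Decidable q'] (hst : (s + 1) / 2 + 1 = t / 2)
    (hp : p → s % 2 = 0 ∧ 2 ≤ s) (hq : q ↔ s % 2 = 0) (hp' : p' ↔ t % 2 = 0)
    (hq' : q' → t % 2 = 0) :
    modified g p q s * modified g False q' t - modified g p' q' t * modified g p False s ∈
      relSpace k g := by
  have h1 := rel_mem (k := k) (g := g) (a := s) (b := t) (by unfold Precedes; omega)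
  rw [rel_eq_adjacent hst] at h1
  -- The bracket is bilinear: it is the sum of the relations pairing `s`, and `s - 1` if present,
  -- with `t`, and `t + 1` if present.
  have h2 : q' → (g s + if q then g (s + 1) else 0) * g (t + 1) - g (t + 1) * g s ∈
      relSpace k g := by
    intro h
    have h2 := rel_mem (k := k) (g := g) (a := s) (b := t + 1)
      (by have := hq' h; unfold Precedes; omega)
    have := hq' h
    rw [rel_eq_adjacent (by omega), if_neg (show ¬ (t + 1) % 2 = 0 by omega)] at h2
    simpa [hq] using h2
  have h3 : p → g (s - 1) * g t - (g t + if p' then g (t - 1) else 0) * g (s - 1) ∈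
      relSpace k g := by
    intro h
    have := hp h
    have h2 := rel_mem (k := k) (g := g) (a := s - 1) (b := t) (by unfold Precedes; omega)
    rw [rel_eq_adjacent (by omega), if_neg (show ¬ (s - 1) % 2 = 0 by omega)] at h2
    simpa [hp'] using h2
  have h4 : p → q' → g (s - 1) * g (t + 1) - g (t + 1) * g (s - 1) ∈ relSpace k g := by
    intro h h'
    have := hp h
    have := hq' h'
    exact commutator_mem (by unfold Precedes; omega) (by omega)
  simp only [← hq, ← hp'] at h1
  unfold modified
  by_cases hP : p <;> by_cases hQ : q'
  · convert add_mem h1 (add_mem (h2 hQ) (add_mem (h3 hP) (h4 hP hQ))) using 1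
    simp only [hP, hQ, if_true, if_false]
    noncomm_ring
  · convert add_mem h1 (h3 hP) using 1
    simp only [hP, hQ, if_true, if_false]
    noncomm_ring
  · convert add_mem h1 (h2 hQ) using 1
    simp only [hP, hQ, if_true, if_false]
    noncomm_ring
  · convert h1 using 1
    simp only [hP, hQ, if_false]
    noncomm_ring

/-- A family of pairwise disjoint intervals. -/
def Disjointed (S : Finset ℕ) : Prop := ∀ s ∈ S, ∀ t ∈ S, s < t → Precedes s t

theorem Disjointed.subset {S S' : Finset ℕ} (h : Disjointed S) (h' : S' ⊆ S) : Disjointed S' :=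
  fun s hs t ht => h s (h' hs) t (h' ht)

/-- Removing `s` and `t` in either order gives the same product modulo `R`. If they are adjacent,
the first removal uncovers a neighbour of the other interval; otherwise it changes nothing for the
other. For two nodes one node apart, the same middle node decides both modifications. -/
theorem pseudoRoot_bracket_mem {S : Finset ℕ} (hS : Disjointed S) {s t : ℕ} (hs : s ∈ S)
    (ht : t ∈ S) (hst : s < t) :
    pseudoRoot g S s * pseudoRoot g (S.erase s) t -
      pseudoRoot g S t * pseudoRoot g (S.erase t) s ∈ relSpace k g := by
  have hp := hS s hs t ht hst
  unfold Precedes at hp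
  have L1 : LeftCovered (S.erase t) s ↔ LeftCovered S s := by
    simp only [LeftCovered, Finset.mem_erase]; grind
  have R1 : RightCovered (S.erase s) t ↔ RightCovered S t := by
    simp only [RightCovered, Finset.mem_erase]; grind
  have l0 : LeftCovered S s → s % 2 = 0 ∧ 2 ≤ s := by
    simp only [LeftCovered]; grind
  by_cases hadj : (s + 1) / 2 + 1 = t / 2
  -- The left neighbour of the node `t` is the right end of `s`, and another interval covering it
  -- would meet `s`.
  · have L2 : ¬ LeftCovered (S.erase s) t := by
      simp only [LeftCovered, Finset.mem_erase]
      rintro ⟨h0, u, ⟨hu, hu'⟩, h⟩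
      rcases lt_or_gt_of_ne hu with h1 | h1
      · have := hS u hu' s hs h1
        unfold Precedes at this; omega
      · have := hS s hs u hu' h1
        unfold Precedes at this; omega
    have R2 : ¬ RightCovered (S.erase t) s := by
      simp only [RightCovered, Finset.mem_erase]
      rintro ⟨h0, u, ⟨hu, hu'⟩, h⟩
      rcases lt_or_gt_of_ne hu with h1 | h1
      · have := hS u hu' t ht h1
        unfold Precedes at this; omega
      · have := hS t ht u hu' h1
        unfold Precedes at this; omega
    have := modified_adjacent_mem (k := k) (g := g) (p := LeftCovered S s)
      (q := RightCovered S s) (p' := LeftCovered S t) (q' := RightCovered S t) hadj l0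
      ⟨fun h => h.1, fun h => ⟨h, t, ht, by omega⟩⟩ ⟨fun h => h.1, fun h => ⟨h, s, hs, by omega⟩⟩
      (fun h => h.1)
    simpa [pseudoRoot, modified, L1, R1, L2, R2] using this
  · have L2 : LeftCovered (S.erase s) t ↔ LeftCovered S t := by
      simp only [LeftCovered, Finset.mem_erase]; grind
    have R2 : RightCovered (S.erase t) s ↔ RightCovered S s := by
      simp only [RightCovered, Finset.mem_erase]; grind
    simp only [pseudoRoot, modified, L1, R1, L2, R2]
    by_cases hgap : s % 2 = 0 ∧ t = s + 4
    · refine modified_gap_mem hgap.1 hgap.2 (fun h => (l0 h).2) ⟨?_, ?_⟩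
      · rintro ⟨h0, u, hu, h⟩
        refine ⟨by omega, u, hu, ?_⟩
        rcases h with rfl | rfl
        · omega
        · have := hS _ hu t ht (by omega)
          unfold Precedes at this; omega
      · rintro ⟨h0, u, hu, h⟩
        refine ⟨by omega, u, hu, ?_⟩
        rcases h with h | h
        · omega
        · have := hS s hs u hu (by omega)
          unfold Precedes at this; omega
    · exact modified_far_mem (by omega) l0 (fun h => h.1) (fun h => h.1) (fun h => h.1) (by omega)

end Abstract

/-! ### Koszul elements and their leading words. -/

section Abstract

variable {k : Type*} [Field k] {T : Type*} [Ring T] [Algebra k T] (g : ℕ → T)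

variable (k) in
/-- The span of the generators. -/
def genSpace : Submodule k T := Submodule.span k (Set.range g)

/-- The sign `(-1) ^ #{t ∈ S | t < s}`. -/
def signAt (S : Finset ℕ) (s : ℕ) : T := (-1) ^ (S.filter (· < s)).card

/-- The element of the Koszul dual coalgebra attached to a family of `m` disjoint intervals. -/
def koszulElement : ℕ → Finset ℕ → T
  | 0, _ => 1
  | m + 1, S => ∑ s ∈ S, signAt S s * pseudoRoot g S s * koszulElement m (S.erase s)

variable {g}

theorem gen_mem (a : ℕ) : g a ∈ genSpace k g := Submodule.subset_span ⟨a, rfl⟩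

theorem pseudoRoot_mem (S : Finset ℕ) (s : ℕ) : pseudoRoot g S s ∈ genSpace k g := by
  unfold pseudoRoot modified
  refine add_mem (add_mem (gen_mem _) ?_) ?_ <;> split_ifs <;> simp [gen_mem]

theorem signAt_mul_mem {M : Submodule k T} (S : Finset ℕ) (s : ℕ) {x : T} (h : x ∈ M) :
    signAt S s * x ∈ M := by
  unfold signAt
  rcases neg_one_pow_eq_or T (S.filter (· < s)).card with h' | h' <;> simpa [h']

/-- Removing `t` first does not affect the count below `s`, while removing `s` first lowers the
count below `t` by one. -/
theorem signAt_swap {S : Finset ℕ} {s t : ℕ} (hs : s ∈ S) (hst : s < t) :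
    (signAt S t * signAt (S.erase t) s : T) = - (signAt S s * signAt (S.erase s) t) := by
  unfold signAt
  have h1 : (S.erase t).filter (· < s) = S.filter (· < s) := by
    ext; simp; omega
  have h2 : S.filter (· < t) = insert s ((S.erase s).filter (· < t)) := by
    ext; simp; grind
  rw [h1, h2, Finset.card_insert_of_notMem (by simp), pow_succ]
  rw [← pow_add, add_comm, pow_add]; noncomm_ring

theorem signAt_commute (S : Finset ℕ) (s : ℕ) (x : T) : Commute (signAt S s) x :=
  (Commute.neg_one_left x).pow_left _

theorem koszulElement_mem_pow (m : ℕ) (S : Finset ℕ) :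
    koszulElement g m S ∈ genSpace k g ^ m := by
  induction m generalizing S with
  | zero => simp [koszulElement, Submodule.one_le.1 le_rfl]
  | succ m ih =>
    rw [koszulElement, pow_succ']
    refine Submodule.sum_mem _ fun s _ => ?_
    rw [mul_assoc]
    exact signAt_mul_mem _ _ (Submodule.mul_mem_mul (pseudoRoot_mem S s) (ih _))

/-- Groups the two orders in which a pair can be removed. -/
theorem sum_sum_erase_mem (W : Submodule k T) (S : Finset ℕ) (F : ℕ → ℕ → T)
    (h : ∀ s ∈ S, ∀ t ∈ S, s < t → F s t + F t s ∈ W) :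
    ∑ s ∈ S, ∑ t ∈ S.erase s, F s t ∈ W := by
  have e : ∑ s ∈ S, ∑ t ∈ S.erase s, F s t =
      ∑ s ∈ S, ∑ t ∈ S with s < t, (F s t + F t s) := by
    have e1 : ∀ s ∈ S, ∑ t ∈ S.erase s, F s t =
        ∑ t ∈ S with s < t, F s t + ∑ t ∈ S with t < s, F s t := by
      intro s _
      rw [← Finset.sum_union]
      · refine Finset.sum_congr ?_ fun _ _ => rfl
        ext t; simp; grind
      · rw [Finset.disjoint_filter]; intro t _ h1 h2; exact lt_asymm h1 h2
    rw [Finset.sum_congr rfl e1]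
    simp_rw [Finset.sum_add_distrib]
    congr 1
    simp_rw [Finset.sum_filter]
    exact Finset.sum_comm
  rw [e]
  refine Submodule.sum_mem _ fun s hs => Submodule.sum_mem _ fun t ht => ?_
  rw [Finset.mem_filter] at ht
  exact h s hs t ht.1 ht.2

/-- The Koszul elements lie in `V ^ a * R * V ^ b`. -/
theorem koszulElement_mem {S : Finset ℕ} (hS : Disjointed S) (a b : ℕ) :
    koszulElement g (a + 2 + b) S ∈ genSpace k g ^ a * relSpace k g * genSpace k g ^ b := by
  induction a generalizing S with
  | zero =>
    rw [pow_zero, one_mul, show 0 + 2 + b = b + 1 + 1 by omega, koszulElement]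
    -- After the first two removals are expanded, the orders `s, t` and `t, s` carry opposite signs
    -- and the same remaining factor, so together they give a bracket times that factor.
    simp_rw [koszulElement, Finset.mul_sum]
    refine sum_sum_erase_mem _ S _ fun s hs t ht hst => ?_
    have h1 : ∀ s t, signAt S s * pseudoRoot g S s * (signAt (S.erase s) t *
        pseudoRoot g (S.erase s) t * koszulElement g b ((S.erase s).erase t)) =
        (signAt S s * signAt (S.erase s) t) * (pseudoRoot g S s * pseudoRoot g (S.erase s) t *
          koszulElement g b ((S.erase s).erase t)) := by
      intro s t
      have := (signAt_commute (S.erase s) t (pseudoRoot g S s)).eq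
      simp only [mul_assoc]
      rw [← mul_assoc (pseudoRoot g S s), ← this]
      simp only [mul_assoc]
    rw [h1, h1, signAt_swap hs hst, Finset.erase_right_comm (a := t), neg_mul, ← sub_eq_add_neg,
      ← mul_sub, ← sub_mul, mul_assoc]
    have h2 := Submodule.mul_mem_mul (pseudoRoot_bracket_mem (k := k) (g := g) hS hs ht hst)
      (koszulElement_mem_pow (k := k) (g := g) b ((S.erase s).erase t))
    exact signAt_mul_mem S s (signAt_mul_mem (S.erase s) t h2)
  | succ a ih =>
    have e : genSpace k g ^ (a + 1) * relSpace k g * genSpace k g ^ b =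
        genSpace k g * (genSpace k g ^ a * relSpace k g * genSpace k g ^ b) := by
      rw [pow_succ']; simp only [mul_assoc]
    rw [show a + 1 + 2 + b = (a + 2 + b) + 1 by omega, koszulElement, e]
    refine Submodule.sum_mem _ fun s _ => ?_
    have h := Submodule.mul_mem_mul (pseudoRoot_mem (k := k) (g := g) S s)
      (ih (hS.subset (Finset.erase_subset s _)))
    rw [mul_assoc (signAt S s)]
    exact signAt_mul_mem S s h

variable (g) in
/-- The monomial of a word in the generators. -/
def word (x : List ℕ) : T := (x.map g).prod

variable (k g) in
/-- The span of the words of the same length as `x` that come after `x`. -/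
def laterSpace (x : List ℕ) : Submodule k T :=
  Submodule.span k {z | ∃ y : List ℕ, y.length = x.length ∧ x < y ∧ z = word g y}

@[simp] theorem word_nil : word g [] = 1 := rfl

@[simp] theorem word_cons (a : ℕ) (x : List ℕ) : word g (a :: x) = g a * word g x := by
  simp [word]

theorem word_append (x y : List ℕ) : word g (x ++ y) = word g x * word g y := by
  simp [word]

theorem genSpace_pow (m : ℕ) :
    genSpace k g ^ m = Submodule.span k {z | ∃ x : List ℕ, x.length = m ∧ z = word g x} := by
  induction m with
  | zero =>
    rw [pow_zero, Submodule.one_eq_span]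
    congr 1; ext z; simp [List.length_eq_zero_iff]
  | succ m ih =>
    rw [pow_succ', ih, genSpace, Submodule.span_mul_span]
    congr 1; ext z
    simp only [Set.mem_mul, Set.mem_range, Set.mem_ofPred_eq]
    constructor
    · rintro ⟨_, ⟨a, rfl⟩, _, ⟨x, hx, rfl⟩, rfl⟩
      exact ⟨a :: x, by simp [hx], by simp⟩
    · rintro ⟨x, hx, rfl⟩
      match x, hx with
      | a :: x, hx => exact ⟨_, ⟨a, rfl⟩, _, ⟨x, by simpa using hx, rfl⟩, by simp⟩

theorem append_lt_append_of_lt {x x' : List ℕ} (y y' : List ℕ) (hl : x'.length = x.length)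
    (h : x < x') : x ++ y < x' ++ y' := by
  induction x generalizing x' with
  | nil => simp at hl; subst hl; exact absurd h (lt_irrefl _)
  | cons a x ih =>
    match x', hl with
    | a' :: x', hl =>
      rw [List.cons_lt_cons_iff] at h
      simp only [List.cons_append, List.cons_lt_cons_iff]
      rcases h with h | ⟨h, h'⟩
      · exact Or.inl h
      · exact Or.inr ⟨h, ih (by simpa using hl) h'⟩

theorem append_lt_append_left (x : List ℕ) {y y' : List ℕ} (h : y < y') : x ++ y < x ++ y' := by
  induction x with
  | nil => simpa
  | cons a x ih => simpa [List.cons_lt_cons_iff] using ih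

/-- Leading words multiply: among words of equal length the lexicographic order is compatible with
concatenation. -/
theorem mul_mem_laterSpace {x y : List ℕ} {e f : T} (he : e - word g x ∈ laterSpace k g x)
    (hf : f - word g y ∈ laterSpace k g y) :
    e * f - word g (x ++ y) ∈ laterSpace k g (x ++ y) := by
  have hf' : f ∈ Submodule.span k {z | ∃ y' : List ℕ, y'.length = y.length ∧ z = word g y'} := by
    rw [← sub_add_cancel f (word g y)]
    refine add_mem (Submodule.span_mono ?_ hf) (Submodule.subset_span ⟨y, rfl, rfl⟩)
    rintro _ ⟨z, hz, -, rfl⟩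
    exact ⟨z, hz, rfl⟩
  have h1 : (e - word g x) * f ∈ laterSpace k g (x ++ y) := by
    refine Submodule.mul_le.2 ?_ (Submodule.mul_mem_mul he hf')
    intro a ha b hb
    have := Submodule.mul_mem_mul ha hb
    rw [laterSpace, Submodule.span_mul_span] at this
    refine Submodule.span_mono ?_ this
    rintro _ ⟨_, ⟨x', hx, hlt, rfl⟩, _, ⟨y', hy, rfl⟩, rfl⟩
    exact ⟨x' ++ y', by simp [hx, hy], append_lt_append_of_lt _ _ hx hlt, (word_append _ _).symm⟩
  have h2 : word g x * (f - word g y) ∈ laterSpace k g (x ++ y) := by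
    have := Submodule.mul_mem_mul (Submodule.mem_span_singleton_self (R := k) (word g x)) hf
    rw [laterSpace, Submodule.span_mul_span] at this
    refine Submodule.span_mono ?_ this
    rintro _ ⟨_, rfl, _, ⟨y', hy, hlt, rfl⟩, rfl⟩
    exact ⟨x ++ y', by simp [hy], append_lt_append_left _ hlt, (word_append _ _).symm⟩
  convert add_mem h1 h2 using 1
  rw [word_append]; noncomm_ring

/-- The leading word of a Koszul element. -/
theorem koszulElement_sub_word_mem (x : List ℕ) (hx : x.Pairwise Precedes) :
    koszulElement g x.length x.toFinset - word g x ∈ laterSpace k g x := by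
  induction x with
  | nil => simp [koszulElement]
  | cons a x ih =>
    obtain ⟨ha, hx'⟩ := List.pairwise_cons.1 hx
    have hlt : ∀ t ∈ x, a < t := fun t ht => by
      have := ha t ht; unfold Precedes at this; omega
    have hmem : a ∉ x.toFinset := fun h => lt_irrefl _ (hlt a (List.mem_toFinset.1 h))
    have later : ∀ b z, a < b → z ∈ genSpace k g ^ x.length →
        g b * z ∈ laterSpace k g (a :: x) := by
      intro b z hb hz
      rw [genSpace_pow] at hz
      have := Submodule.mul_mem_mul (Submodule.mem_span_singleton_self (R := k) (g b)) hz
      rw [Submodule.span_mul_span] at this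
      refine Submodule.span_mono ?_ this
      rintro _ ⟨_, rfl, _, ⟨y, hy, rfl⟩, rfl⟩
      exact ⟨b :: y, by simp [hy], by simp [List.cons_lt_cons_iff, hb], (word_cons _ _).symm⟩
    rw [List.length_cons, koszulElement, List.toFinset_cons, Finset.sum_insert hmem,
      add_sub_right_comm]
    refine add_mem ?_ (Submodule.sum_mem _ fun t ht => ?_)
    · rw [Finset.erase_insert hmem]
      have hs : (signAt (insert a x.toFinset) a : T) = 1 := by
        unfold signAt
        rw [Finset.filter_eq_empty_iff.2, Finset.card_empty, pow_zero]
        intro t ht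
        rcases Finset.mem_insert.1 ht with rfl | ht
        · exact lt_irrefl _
        · exact (hlt t (List.mem_toFinset.1 ht)).not_gt
      -- Here `a` is the least interval, so its only possible correction is the edge `a + 1`, which
      -- starts later words.
      have hl : ¬ LeftCovered (insert a x.toFinset) a := by
        rintro ⟨-, t, ht, h⟩
        rcases Finset.mem_insert.1 ht with rfl | ht
        · omega
        · have := hlt t (List.mem_toFinset.1 ht); omega
      rw [hs, one_mul, pseudoRoot, modified, if_neg hl, add_zero, add_mul, add_sub_right_comm]
      refine add_mem ?_ ?_
      · have := mul_mem_laterSpace (k := k) (x := [a]) (e := g a) (by simp) (ih hx')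
        simpa using this
      · split_ifs
        · exact later _ _ (by omega) (koszulElement_mem_pow _ _)
        · simp
    · rw [List.mem_toFinset] at ht
      have hat := ha t ht
      have htlt := hlt t ht
      rw [mul_assoc]
      refine signAt_mul_mem _ _ ?_
      have hm := koszulElement_mem_pow (k := k) (g := g) x.length
        ((insert a x.toFinset).erase t)
      rw [pseudoRoot, modified, add_mul, add_mul]
      refine add_mem (add_mem (later _ _ htlt hm) ?_) ?_
      · split_ifs with h
        · refine later _ _ ?_ hm
          -- The left neighbour of `t` is covered by some `u ≥ a` with `u + 2 ≤ t`, so even the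
          -- smallest letter `t - 1` exceeds `a`.
          obtain ⟨-, u, hu, h⟩ := h
          rcases Finset.mem_insert.1 hu with rfl | hu
          · omega
          · have := hlt u (List.mem_toFinset.1 hu); omega
        · simp
      · split_ifs
        · exact later _ _ (by omega) hm
        · simp

end Abstract

/-! ### The distributing basis. -/

section Abstract

variable {k : Type*} [Field k] {T : Type*} [Ring T] [Algebra k T] {g : ℕ → T}

/-- The letters of the word `x` in the positions `i` and `i + 1` are the leading term of a
relation. -/
def ReducibleAt (x : List ℕ) (i : ℕ) : Prop :=
  ∃ y c d z, x = y ++ c :: d :: z ∧ y.length = i ∧ Precedes c d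

theorem Precedes.lt {a b : ℕ} (h : Precedes a b) : a < b := by unfold Precedes at h; omega

theorem Precedes.trans {a b c : ℕ} (h : Precedes a b) (h' : Precedes b c) : Precedes a c := by
  unfold Precedes at *; omega

theorem disjointed_toFinset {x : List ℕ} (hx : x.Pairwise Precedes) : Disjointed x.toFinset := by
  induction x with
  | nil => simp [Disjointed]
  | cons a x ih =>
    obtain ⟨ha, hx'⟩ := List.pairwise_cons.1 hx
    intro s hs t ht hst
    rw [List.mem_toFinset, List.mem_cons] at hs ht
    rcases hs with rfl | hs <;> rcases ht with rfl | ht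
    · exact absurd hst (lt_irrefl _)
    · exact ha t ht
    · exact absurd (ha s hs).lt hst.not_gt
    · exact ih hx' s (List.mem_toFinset.2 hs) t (List.mem_toFinset.2 ht) hst

/-- A nonempty word starts with a maximal run of disjoint intervals. -/
theorem exists_run (a : ℕ) (x : List ℕ) :
    ∃ s y, a :: x = (a :: s) ++ y ∧ (a :: s).Pairwise Precedes ∧
      ∀ c d s' y', a :: s = s' ++ [c] → y = d :: y' → ¬ Precedes c d := by
  induction x generalizing a with
  | nil => exact ⟨[], [], by simp, by simp, by simp⟩
  | cons b x ih =>
    by_cases h : Precedes a b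
    · obtain ⟨s, y, e, hs, hy⟩ := ih b
      refine ⟨b :: s, y, by simp [e], ?_, ?_⟩
      · refine List.pairwise_cons.2 ⟨fun c hc => ?_, hs⟩
        rcases List.mem_cons.1 hc with rfl | hc
        · exact h
        · exact h.trans ((List.pairwise_cons.1 hs).1 c hc)
      · intro c d s' y' e1 e2
        match s', e1 with
        | [], e1 => simp at e1
        | a' :: s'', e1 => exact hy c d s'' y' (by simpa using (List.cons.inj e1).2) e2
    · refine ⟨[], b :: x, by simp, by simp, ?_⟩
      intro c d s' y' e1 e2
      match s', e1 with
      | [], e1 => simp at e1 e2; rwa [← e1, ← e2.1]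
      | a' :: s'', e1 => simp at e1

theorem laterSpace_le (x : List ℕ) : laterSpace k g x ≤ genSpace k g ^ x.length := by
  rw [genSpace_pow]
  refine Submodule.span_mono ?_
  rintro _ ⟨y, hy, -, rfl⟩
  exact ⟨y, hy, rfl⟩

theorem word_mem_pow (x : List ℕ) : word g x ∈ genSpace k g ^ x.length := by
  rw [genSpace_pow]; exact Submodule.subset_span ⟨x, rfl, rfl⟩

variable (k g) in
/-- Every word is the leading word of an element that satisfies all the relations at which the
word is reducible. -/
theorem exists_distributing (x : List ℕ) :
    ∃ e : T, e - word g x ∈ laterSpace k g x ∧ ∀ a b, a + 2 + b = x.length → ReducibleAt x a →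
      e ∈ genSpace k g ^ a * relSpace k g * genSpace k g ^ b := by
  induction hn : x.length using Nat.strong_induction_on generalizing x with
  | _ n ih =>
  subst hn
  match x with
  | [] => exact ⟨1, by simp, fun a b h => by simp at h⟩
  | c₀ :: x =>
    obtain ⟨s, y, e, hs, hy⟩ := exists_run c₀ x
    rw [e] at ih ⊢
    generalize hS : c₀ :: s = S at *
    have hS0 : 0 < S.length := by simp [← hS]
    obtain ⟨f, hf, hf'⟩ := ih y.length (by simp; omega) y rfl
    have hfm : f ∈ genSpace k g ^ y.length := by
      rw [← sub_add_cancel f (word g y)]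
      exact add_mem (laterSpace_le _ hf) (word_mem_pow _)
    -- The Koszul element of the first run, times the element already found for the rest of the
    -- word.
    refine ⟨koszulElement g S.length S.toFinset * f,
      mul_mem_laterSpace (koszulElement_sub_word_mem S hs) hf, ?_⟩
    rintro a b hab ⟨p, c, d, q, he, hp, hcd⟩
    have right : ∀ r, p = S ++ r → y = r ++ c :: d :: q →
        koszulElement g S.length S.toFinset * f ∈
          genSpace k g ^ a * relSpace k g * genSpace k g ^ b := by
      intro r hr hyr
      have h1 := hf' r.length b
        (by rw [he, hr, ← hp, hr] at hab; rw [hyr]; simp at hab ⊢; omega)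
        ⟨r, c, d, q, hyr, rfl, hcd⟩
      have h2 := Submodule.mul_mem_mul (koszulElement_mem_pow (k := k) (g := g) S.length
        S.toFinset) h1
      rwa [← mul_assoc, ← mul_assoc, ← pow_add, ← List.length_append, ← hr, hp] at h2
    -- A reducible pair lies within the rest or within the run; one across the boundary would
    -- contradict the maximality of the run.
    rcases List.append_eq_append_iff.1 he with ⟨r, hr, hyr⟩ | ⟨r, hr, hyr⟩
    · exact right r hr hyr
    · match r, hyr with
      | [], hyr => exact right [] (by simpa using hr.symm) (by simpa using hyr.symm)
      | [c'], hyr =>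
        simp only [List.cons_append, List.nil_append, List.cons.injEq] at hyr
        exact absurd hcd (hy c d p q (by rw [hr, hyr.1]) hyr.2.symm)
      | c' :: d' :: r', hyr =>
        simp only [List.cons_append, List.cons.injEq] at hyr
        have hl : S.length = a + 2 + r'.length := by rw [hr, ← hp]; simp; omega
        have h1 := koszulElement_mem (k := k) (g := g) (disjointed_toFinset hs) a r'.length
        have h2 := Submodule.mul_mem_mul h1 hfm
        rw [mul_assoc _ (genSpace k g ^ r'.length), ← pow_add, ← hl] at h2
        rwa [show r'.length + y.length = b by rw [List.length_append] at hab; omega] at h2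

/-- The words of length `m` in the generators of the path algebra of `n` nodes. -/
abbrev WordIndex (n m : ℕ) : Type := {x : List ℕ // x.length = m ∧ ∀ a ∈ x, a < 2 * n - 1}

instance (n m : ℕ) : Finite (WordIndex n m) := by
  refine Set.Finite.to_subtype (s := {x : List ℕ | x.length = m ∧ ∀ a ∈ x, a < 2 * n - 1}) ?_
  refine ((List.finite_length_eq (Fin (2 * n - 1)) m).image (List.map Fin.val)).subset ?_
  rintro x ⟨hx, h⟩
  refine ⟨x.attach.map fun a => ⟨a.1, h a.1 a.2⟩, by simpa using hx, ?_⟩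
  simp [List.map_map, Function.comp_def]

theorem word_eq_zero {x : List ℕ} {a : ℕ} (ha : a ∈ x) (h : g a = 0) : word g x = 0 :=
  List.prod_eq_zero (List.mem_map.2 ⟨a, ha, h⟩)

theorem rel_eq_zero {n : ℕ} (hg : ∀ a, 2 * n - 1 ≤ a → g a = 0) {c d : ℕ} (h : Precedes c d)
    (hd : 2 * n - 1 ≤ d) : rel g c d = 0 := by
  have hlt := h.lt
  -- An even `d ≥ 2 * n - 1` is at least `2 * n`, so the edge `d - 1` is out of range too.
  have h1 : LeftCovered {c} d → g (d - 1) = 0 := fun h => hg _ (by have := h.1; omega)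
  have h2 : ¬ RightCovered {c} d := by simp [RightCovered]; omega
  have h3 : pseudoRoot g {c} d = 0 := by
    unfold pseudoRoot modified
    rw [hg d hd, if_neg h2]
    split_ifs with h
    · simp [h1 h]
    · simp
  rw [rel, h3, hg d hd]; simp

/-- The elements of `exists_distributing` are unitriangular over the independent words, hence
independent. Those of words reducible at `a` lie in `V^a R V^b`, which is itself spanned by one
product per such word, so they already span it. -/
theorem exists_distributing_family {n : ℕ} (hg : ∀ a, 2 * n - 1 ≤ a → g a = 0) (m : ℕ)
    (hli : LinearIndependent k fun x : WordIndex n m => word g x.1) :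
    ∃ e : WordIndex n m → T, LinearIndependent k e ∧ ∀ a b, a + 2 + b = m →
      ∃ s, genSpace k g ^ a * relSpace k g * genSpace k g ^ b = Submodule.span k (e '' s) := by
  classical
  have := Fintype.ofFinite (WordIndex n m)
  choose e he he' using fun x : WordIndex n m => exists_distributing k g x.1
  have later (x : WordIndex n m) (M : Submodule k T) (h : ∀ y : WordIndex n m, x < y →
      word g y.1 ∈ M) : laterSpace k g x.1 ≤ M := by
    refine Submodule.span_le.2 ?_
    rintro _ ⟨y, hy, hxy, rfl⟩
    by_cases hN : ∀ a ∈ y, a < 2 * n - 1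
    · exact h ⟨y, hy.trans x.2.1, hN⟩ hxy
    · push Not at hN
      obtain ⟨a, ha, hN⟩ := hN
      rw [word_eq_zero ha (hg a hN)]
      exact M.zero_mem
  have hspan : Submodule.span k (Set.range e) =
      Submodule.span k (Set.range fun x : WordIndex n m => word g x.1) := by
    refine le_antisymm (Submodule.span_le.2 ?_) (Submodule.span_le.2 ?_)
    · rintro _ ⟨x, rfl⟩
      rw [← sub_add_cancel (e x) (word g x.1)]
      exact add_mem (later x _ (fun y _ => Submodule.subset_span (Set.mem_range_self y)) (he x))
        (Submodule.subset_span ⟨x, rfl⟩)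
    · rintro _ ⟨x, rfl⟩
      -- Descending induction along the finite word order inverts the triangular system.
      have wf : WellFounded fun x y : WordIndex n m => y < x :=
        (inferInstance : WellFoundedGT (WordIndex n m)).wf
      induction x using wf.induction with
      | _ x ih =>
        have h1 := sub_mem (Submodule.subset_span (R := k) (Set.mem_range_self (f := e) x))
          (later x _ (fun y hy => ih y hy) (he x))
        simpa using h1
  have hlie : LinearIndependent k e := by
    rw [linearIndependent_iff_card_eq_finrank_span] at hli ⊢
    rw [hli, Set.finrank, Set.finrank, hspan]
  refine ⟨e, hlie, fun a b hab => ⟨{x | ReducibleAt x.1 a}, Eq.symm ?_⟩⟩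
  let J := {x : WordIndex n m // ReducibleAt x.1 a}
  choose y c d z hx hy hcd using fun x : J => x.2
  -- The position `a` determines the factorisation of the word, so there is one product for each
  -- reducible word.
  let f : J → T := fun x => word g (y x) * rel g (c x) (d x) * word g (z x)
  have hle : genSpace k g ^ a * relSpace k g * genSpace k g ^ b ≤
      Submodule.span k (Set.range f) := by
    rw [genSpace_pow, genSpace_pow, relSpace, Submodule.span_mul_span, Submodule.span_mul_span,
      Submodule.span_le]
    rintro _ ⟨_, ⟨_, ⟨y', hy', rfl⟩, _, ⟨c', d', hcd', rfl⟩, rfl⟩, _, ⟨z', hz', rfl⟩, rfl⟩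
    by_cases hN : ∀ a ∈ y' ++ c' :: d' :: z', a < 2 * n - 1
    · let x : J := ⟨⟨y' ++ c' :: d' :: z', by simp; omega, hN⟩, y', c', d', z', rfl, hy', hcd'⟩
      obtain ⟨e1, e2⟩ := List.append_inj (hx x) (by rw [hy, hy'])
      simp only [List.cons.injEq] at e2
      refine Submodule.subset_span ⟨x, ?_⟩
      simp only [f, ← e1, ← e2.1, ← e2.2.1, ← e2.2.2]
    · push Not at hN
      obtain ⟨u, hu, hN⟩ := hN
      have hzero : word g y' * rel g c' d' * word g z' = 0 := by
        rw [List.mem_append, List.mem_cons, List.mem_cons] at hu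
        rcases hu with hu | rfl | rfl | hu
        · rw [word_eq_zero hu (hg u hN)]; simp
        · rw [rel_eq_zero hg hcd' (hN.trans hcd'.lt.le)]; simp
        · rw [rel_eq_zero hg hcd' hN]; simp
        · rw [word_eq_zero hu (hg u hN)]; simp
      change word g y' * rel g c' d' * word g z' ∈ Submodule.span k (Set.range f)
      rw [hzero]
      exact Submodule.zero_mem _
  have hge : Submodule.span k (e '' {x | ReducibleAt x.1 a}) ≤
      genSpace k g ^ a * relSpace k g * genSpace k g ^ b := by
    refine Submodule.span_le.2 ?_
    rintro _ ⟨x, hx, rfl⟩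
    exact he' x a b (hab.trans x.2.1.symm) hx
  have hfin : Submodule.span k (e '' {x | ReducibleAt x.1 a}) =
      Submodule.span k (Set.range f) := by
    have : Fintype J := Fintype.ofFinite J
    have : FiniteDimensional k (Submodule.span k (Set.range f)) :=
      FiniteDimensional.span_of_finite k (Set.finite_range f)
    refine Submodule.eq_of_le_of_finrank_le (hge.trans hle) ?_
    have h1 : e '' {x | ReducibleAt x.1 a} = Set.range fun x : J => e x.1 := by
      rw [Set.image_eq_range]; rfl
    have h2 : LinearIndependent k fun x : J => e x.1 := hlie.comp _ Subtype.val_injective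
    rw [linearIndependent_iff_card_eq_finrank_span, Set.finrank] at h2
    rw [h1, ← h2]
    exact finrank_range_le_card f
  exact le_antisymm hge (hle.trans hfin.ge)

end Abstract

/-- Subspaces spanned by parts of one linearly independent family generate a distributive
lattice. -/
theorem generatesDistributive_of_linearIndependent {k M ι : Type*} [Field k] [AddCommGroup M]
    [Module k M] {e : ι → M} (he : LinearIndependent k e) {𝒲 : Set (Submodule k M)}
    (h : ∀ W ∈ 𝒲, ∃ s, W = Submodule.span k (e '' s)) : GeneratesDistributive 𝒲 := by
  let 𝒟 : Set (Submodule k M) := {W | ∃ s, W = Submodule.span k (e '' s)}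
  have hsup (s t : Set ι) : Submodule.span k (e '' s) ⊔ Submodule.span k (e '' t) =
      Submodule.span k (e '' (s ∪ t)) := by
    rw [Set.image_union, Submodule.span_union]
  -- Independence is needed only for intersections.
  have hinf (s t : Set ι) : Submodule.span k (e '' s) ⊓ Submodule.span k (e '' t) =
      Submodule.span k (e '' (s ∩ t)) := by
    rw [Finsupp.span_image_eq_map_linearCombination, Finsupp.span_image_eq_map_linearCombination,
      Finsupp.span_image_eq_map_linearCombination, ← Submodule.map_inf _ he,
      Finsupp.supported_inter]
  have hD : latticeClosure 𝒲 ⊆ 𝒟 := by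
    refine latticeClosure_min h ⟨?_, ?_⟩
    · rintro _ ⟨s, rfl⟩ _ ⟨t, rfl⟩
      exact ⟨s ∪ t, hsup s t⟩
    · rintro _ ⟨s, rfl⟩ _ ⟨t, rfl⟩
      exact ⟨s ∩ t, hinf s t⟩
  intro x hx y hy z hz
  obtain ⟨s, rfl⟩ := hD hx
  obtain ⟨t, rfl⟩ := hD hy
  obtain ⟨u, rfl⟩ := hD hz
  rw [hsup, hinf, hinf, hinf, hsup, Set.inter_union_distrib_left]

/-! ### From a presentation by quadratic relations to the tensor algebra. -/

section Quadratic

variable {k : Type*} [Field k]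

/-- The degree 2 part of a two-sided ideal of the tensor algebra that is generated in degree 2. -/
theorem mem_span_of_mem_twoSidedIdeal_span {V : Type*} [AddCommGroup V] [Module k V]
    {s : Set (TensorAlgebra k V)} (hs : s ⊆ (LinearMap.range (TensorAlgebra.ι k (M := V)) ^ 2 :))
    {x : TensorAlgebra k V} (hx : x ∈ TwoSidedIdeal.span s)
    (hx2 : x ∈ LinearMap.range (TensorAlgebra.ι k (M := V)) ^ 2) : x ∈ Submodule.span k s := by
  set P := LinearMap.range (TensorAlgebra.ι k (M := V)) with hP
  -- `H` collects the degrees at least 3. The sum `span s ⊔ H` is stable under multiplication on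
  -- both sides, so it contains the ideal, and `H` meets degree 2 trivially.
  set H : Submodule k (TensorAlgebra k V) := ⨆ m ∈ Set.Ici 3, P ^ m with hH
  have hs' : Submodule.span k s ≤ P ^ 2 := Submodule.span_le.2 hs
  have h3 : P ^ 3 ≤ H := le_iSup₂_of_le (f := fun m (_ : m ∈ Set.Ici 3) => P ^ m) 3 (Set.mem_Ici.2 le_rfl) le_rfl
  have left : P * (Submodule.span k s ⊔ H) ≤ Submodule.span k s ⊔ H := by
    refine le_trans ?_ le_sup_right
    rw [Submodule.mul_sup, hH]
    refine sup_le ((mul_le_mul_right hs' P).trans ?_) ?_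
    · rw [← pow_succ']; exact h3
    · rw [Submodule.mul_iSup]
      refine iSup_le fun m => ?_
      rw [Submodule.mul_iSup]
      refine iSup_le fun hm => ?_
      rw [← pow_succ']
      exact le_iSup₂_of_le (f := fun m (_ : m ∈ Set.Ici 3) => P ^ m) (m + 1)
        (le_trans (Set.mem_Ici.1 hm) (Nat.le_succ m)) le_rfl
  have right : (Submodule.span k s ⊔ H) * P ≤ Submodule.span k s ⊔ H := by
    refine le_trans ?_ le_sup_right
    rw [Submodule.sup_mul, hH]
    refine sup_le ((mul_le_mul_left hs' P).trans ?_) ?_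
    · rw [← pow_succ]; exact h3
    · rw [Submodule.iSup_mul]
      refine iSup_le fun m => ?_
      rw [Submodule.iSup_mul]
      refine iSup_le fun hm => ?_
      rw [← pow_succ]
      exact le_iSup₂_of_le (f := fun m (_ : m ∈ Set.Ici 3) => P ^ m) (m + 1)
        (le_trans (Set.mem_Ici.1 hm) (Nat.le_succ m)) le_rfl
  have left' (a : TensorAlgebra k V) : ∀ y ∈ Submodule.span k s ⊔ H,
      a * y ∈ Submodule.span k s ⊔ H := by
    induction a using TensorAlgebra.induction with
    | algebraMap r => intro y hy; rw [← Algebra.smul_def]; exact Submodule.smul_mem _ _ hy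
    | ι v => exact fun y hy => left (Submodule.mul_mem_mul ⟨v, rfl⟩ hy)
    | mul a b ha hb => intro y hy; rw [mul_assoc]; exact ha _ (hb _ hy)
    | add a b ha hb => intro y hy; rw [add_mul]; exact add_mem (ha _ hy) (hb _ hy)
  have right' (a : TensorAlgebra k V) : ∀ y ∈ Submodule.span k s ⊔ H,
      y * a ∈ Submodule.span k s ⊔ H := by
    induction a using TensorAlgebra.induction with
    | algebraMap r =>
      intro y hy; rw [← Algebra.commutes, ← Algebra.smul_def]; exact Submodule.smul_mem _ _ hy
    | ι v => exact fun y hy => right (Submodule.mul_mem_mul hy ⟨v, rfl⟩)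
    | mul a b ha hb => intro y hy; rw [← mul_assoc]; exact hb _ (ha _ hy)
    | add a b ha hb => intro y hy; rw [mul_add]; exact add_mem (ha _ hy) (hb _ hy)
  have hmem : x ∈ Submodule.span k s ⊔ H := by
    clear hx2
    induction hx using TwoSidedIdeal.span_induction with
    | mem x hx => exact Submodule.mem_sup_left (Submodule.subset_span hx)
    | zero => exact zero_mem _
    | add x y _ _ hx hy => exact add_mem hx hy
    | neg x _ hx => exact neg_mem hx
    | left_absorb a x _ hx => exact left' a x hx
    | right_absorb a x _ hx => exact right' a x hx
  obtain ⟨y, hy, z, hz, rfl⟩ := Submodule.mem_sup.1 hmem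
  have hind : iSupIndep fun m : ℕ => P ^ m :=
    (DirectSum.Decomposition.isInternal (fun m : ℕ => P ^ m)).submodule_iSupIndep
  have hz2 : z ∈ P ^ 2 := by simpa using sub_mem hx2 (hs' hy)
  have hz0 : z = 0 := Submodule.disjoint_def.1
    (hind.disjoint_biSup (x := 2) (y := Set.Ici 3) (by simp)) z hz2 hz
  simpa [hz0] using hy

variable {X A : Type*} [Ring A] [Algebra k A] {q : FreeAlgebra k X →ₐ[k] A}
  {rels : Set (FreeAlgebra k X)} {V : Submodule k A}

/-- The lift of a presentation of an algebra to the tensor algebra on the span of the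
generators. -/
noncomputable def toTensor (q : FreeAlgebra k X →ₐ[k] A) (V : Submodule k A)
    (hV : ∀ x, q (FreeAlgebra.ι k x) ∈ V) : FreeAlgebra k X →ₐ[k] TensorAlgebra k V :=
  FreeAlgebra.lift k fun x => TensorAlgebra.ι k ⟨q (FreeAlgebra.ι k x), hV x⟩

variable {hV : ∀ x, q (FreeAlgebra.ι k x) ∈ V}

theorem tensorEval_toTensor (x : FreeAlgebra k X) : tensorEval V (toTensor q V hV x) = q x := by
  have : (tensorEval V).comp (toTensor q V hV) = q := by
    refine FreeAlgebra.hom_ext (funext fun B => ?_)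
    simp [toTensor, tensorEval]
  exact DFunLike.congr_fun this x

theorem span_range_mk_eq_top
    (hspan : V = Submodule.span k (Set.range fun x => q (FreeAlgebra.ι k x))) :
    Submodule.span k (Set.range fun x => (⟨q (FreeAlgebra.ι k x), hV x⟩ : V)) = ⊤ := by
  refine Submodule.map_injective_of_injective V.injective_subtype ?_
  rw [Submodule.map_span, ← Set.range_comp]
  simpa [Function.comp_def] using hspan.symm

theorem range_ι_eq_span
    (hspan : V = Submodule.span k (Set.range fun x => q (FreeAlgebra.ι k x))) :
    LinearMap.range (TensorAlgebra.ι k (M := V)) =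
      Submodule.span k (Set.range fun x => toTensor q V hV (FreeAlgebra.ι k x)) := by
  rw [LinearMap.range_eq_map, ← span_range_mk_eq_top (hV := hV) hspan, Submodule.map_span,
    ← Set.range_comp]
  simp [Function.comp_def, toTensor]

theorem toTensor_surjective
    (hspan : V = Submodule.span k (Set.range fun x => q (FreeAlgebra.ι k x))) :
    Function.Surjective (toTensor q V hV) := by
  intro x
  rw [← AlgHom.mem_range]
  induction x using TensorAlgebra.induction with
  | algebraMap r => exact Subalgebra.algebraMap_mem _ r
  | ι v =>
    have h : LinearMap.range (TensorAlgebra.ι k (M := V)) ≤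
        Subalgebra.toSubmodule (toTensor q V hV).range := by
      rw [range_ι_eq_span (hV := hV) hspan, Submodule.span_le]
      rintro _ ⟨x, rfl⟩
      exact ⟨_, rfl⟩
    exact h ⟨v, rfl⟩
  | mul a b ha hb => exact mul_mem ha hb
  | add a b ha hb => exact add_mem ha hb

/-- `q` factors as `tensorEval V` after the surjection `toTensor`, so the kernel of `tensorEval V`
is the image of the kernel of `q`. -/
theorem ker_tensorEval
    (hspan : V = Submodule.span k (Set.range fun x => q (FreeAlgebra.ι k x)))
    (hker : TwoSidedIdeal.ker q = TwoSidedIdeal.span rels) :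
    TwoSidedIdeal.ker (tensorEval V) = TwoSidedIdeal.span (toTensor q V hV '' rels) := by
  refine le_antisymm (fun x hx => ?_) (TwoSidedIdeal.span_le.2 ?_)
  · obtain ⟨y, rfl⟩ := toTensor_surjective (hV := hV) hspan x
    rw [TwoSidedIdeal.mem_ker, tensorEval_toTensor, ← TwoSidedIdeal.mem_ker, hker] at hx
    have h : TwoSidedIdeal.span rels ≤ TwoSidedIdeal.comap (toTensor q V hV)
        (TwoSidedIdeal.span (toTensor q V hV '' rels)) :=
      TwoSidedIdeal.span_le.2 fun z hz =>
        (TwoSidedIdeal.mem_comap _).2 (TwoSidedIdeal.subset_span ⟨z, hz, rfl⟩)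
    exact (TwoSidedIdeal.mem_comap _).1 (h hx)
  · rintro _ ⟨y, hy, rfl⟩
    rw [SetLike.mem_coe, TwoSidedIdeal.mem_ker, tensorEval_toTensor, ← TwoSidedIdeal.mem_ker, hker]
    exact TwoSidedIdeal.subset_span hy

theorem quadRelations_eq
    (hspan : V = Submodule.span k (Set.range fun x => q (FreeAlgebra.ι k x)))
    (hker : TwoSidedIdeal.ker q = TwoSidedIdeal.span rels)
    (hquad : toTensor q V hV '' rels ⊆ (tensorPiece V 2 : Set (TensorAlgebra k V))) :
    quadRelations V = Submodule.span k (toTensor q V hV '' rels) := by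
  refine le_antisymm ?_ (Submodule.span_le.2 fun x hx => ⟨hquad hx, ?_⟩)
  · rintro x ⟨hx, hx'⟩
    refine mem_span_of_mem_twoSidedIdeal_span hquad ?_ hx
    rw [← ker_tensorEval hspan hker]
    exact (TwoSidedIdeal.mem_ker (tensorEval V)).2 hx'
  · have h := TwoSidedIdeal.subset_span hx
    rw [← ker_tensorEval hspan hker] at h
    exact (TwoSidedIdeal.mem_ker (tensorEval V)).1 h

theorem isQuadraticAlgebra (hq : Function.Surjective q)
    (hspan : V = Submodule.span k (Set.range fun x => q (FreeAlgebra.ι k x)))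
    (hker : TwoSidedIdeal.ker q = TwoSidedIdeal.span rels)
    (hquad : toTensor q V hV '' rels ⊆ (tensorPiece V 2 : Set (TensorAlgebra k V))) :
    IsQuadraticAlgebra V where
  surjective x := by
    obtain ⟨y, rfl⟩ := hq x
    exact ⟨toTensor q V hV y, tensorEval_toTensor y⟩
  ker_eq := by
    refine le_antisymm ?_ (TwoSidedIdeal.span_le.2 fun x hx => ?_)
    · rw [ker_tensorEval (hV := hV) hspan hker, quadRelations_eq hspan hker hquad]
      exact TwoSidedIdeal.span_mono Submodule.subset_span
    · exact (TwoSidedIdeal.mem_ker _).2 hx.2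

end Quadratic

/-! ### The two-step quotient as one quotient of the free algebra. -/

section Presentation

variable (k : Type*) [Field k] {n : ℕ} (F : NodeComplex n)

/-- The relations of `Q_n(F)` in the free algebra. -/
def freeRelations : Set (FreeAlgebra k (NodeSet n)) :=
  {z | (∃ x y, QRel k n x y ∧ z = x - y) ∨ ∃ B : NodeSet n, B.1 ∉ F.faces ∧ z = FreeAlgebra.ι k B}

/-- The presentation of `Q_n(F)`. -/
noncomputable def presentation : FreeAlgebra k (NodeSet n) →ₐ[k] QComplex k F :=
  (RingQuot.mkAlgHom k (ComplexRel k F)).comp (RingQuot.mkAlgHom k (QRel k n))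

theorem presentation_surjective : Function.Surjective (presentation k F) :=
  (RingQuot.mkAlgHom_surjective k _).comp (RingQuot.mkAlgHom_surjective k _)

/-- The quotient of the free algebra by the span satisfies the relations of both steps, so its
projection factors through `presentation k F`. -/
theorem ker_presentation :
    TwoSidedIdeal.ker (presentation k F) = TwoSidedIdeal.span (freeRelations k F) := by
  refine le_antisymm ?_ (TwoSidedIdeal.span_le.2 ?_)
  · set I := TwoSidedIdeal.span (freeRelations k F) with hI
    let π : FreeAlgebra k (NodeSet n) →ₐ[k] I.ringCon.Quotient :=
      { I.ringCon.mk' with commutes' := fun _ => rfl }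
    have hπ (x) : π x = 0 ↔ x ∈ I := by
      change I.ringCon.mk' x = 0 ↔ _
      rw [← TwoSidedIdeal.mem_ker, TwoSidedIdeal.ker_ringCon_mk']
    let φ : QAlg k n →ₐ[k] I.ringCon.Quotient := RingQuot.liftAlgHom k
      ⟨π, fun x y h => by
        rw [← sub_eq_zero, ← map_sub, hπ]
        exact TwoSidedIdeal.subset_span (Or.inl ⟨x, y, h, rfl⟩)⟩
    have hφ (x) : φ (RingQuot.mkAlgHom k (QRel k n) x) = π x :=
      RingQuot.liftAlgHom_mkAlgHom_apply _ _ _ _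
    let ψ : QComplex k F →ₐ[k] I.ringCon.Quotient := RingQuot.liftAlgHom k
      ⟨φ, fun x y h => by
        obtain ⟨B, hB⟩ := h
        rw [QAlg.u, hφ, map_zero, hπ]
        exact TwoSidedIdeal.subset_span (Or.inr ⟨B, hB, rfl⟩)⟩
    have hψ (x) : ψ (RingQuot.mkAlgHom k (ComplexRel k F) x) = φ x :=
      RingQuot.liftAlgHom_mkAlgHom_apply _ _ _ _
    intro x hx
    rw [TwoSidedIdeal.mem_ker] at hx
    rw [← hπ, ← hφ, ← hψ]
    exact (congrArg ψ hx).trans (map_zero ψ)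
  · rintro _ (⟨x, y, h, rfl⟩ | ⟨B, hB, rfl⟩)
    · rw [SetLike.mem_coe, TwoSidedIdeal.mem_ker, map_sub, sub_eq_zero]
      exact congrArg (RingQuot.mkAlgHom k (ComplexRel k F)) (RingQuot.mkAlgHom_rel k h)
    · rw [SetLike.mem_coe, TwoSidedIdeal.mem_ker]
      exact (RingQuot.mkAlgHom_rel k (ComplexRel.rel (k := k) B hB)).trans (map_zero _)

end Presentation

/-! ### The defining relations expressed through `rel`. -/

section Relations

variable {k : Type*} [Field k] {n : ℕ} {T : Type*} [Ring T] [Algebra k T]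

/-- The face of the path complex with the number `a`. -/
def letterFace (n a : ℕ) (h : (a + 1) / 2 < n) : NodeSet n :=
  ⟨{⟨a / 2, by omega⟩, ⟨(a + 1) / 2, h⟩}, Finset.insert_nonempty _ _⟩

/-- The free generator with the number `a`, or `0` if there is none. -/
noncomputable def letter (k : Type*) [Field k] (n a : ℕ) : FreeAlgebra k (NodeSet n) :=
  if h : (a + 1) / 2 < n then FreeAlgebra.ι k (letterFace n a h) else 0

/-- There are `n` nodes and `n - 1` edges; for `n = 0` truncated subtraction gives the correct bound
0. -/
theorem letter_eq_zero {a : ℕ} (h : 2 * n - 1 ≤ a) : letter k n a = 0 := dif_neg (by omega)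

theorem letter_eq {a : ℕ} {i j : Fin n} (hi : i.1 = a / 2) (hj : j.1 = (a + 1) / 2) :
    letter k n a = FreeAlgebra.ι k ⟨{i, j}, Finset.insert_nonempty _ _⟩ := by
  have h : (a + 1) / 2 < n := hj ▸ j.2
  have e1 : i = ⟨a / 2, by omega⟩ := Fin.ext hi
  have e2 : j = ⟨(a + 1) / 2, h⟩ := Fin.ext hj
  rw [letter, dif_pos h]
  congr 1
  exact Subtype.ext (by simp only [letterFace, e1, e2])

theorem mem_faces_pathComplex {B : Finset (Fin n)} :
    B ∈ (pathComplex n).faces ↔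
      (∃ i, B = {i}) ∨ ∃ i j : Fin n, (i.1 + 1 = j.1 ∨ j.1 + 1 = i.1) ∧ B = {i, j} := by
  simp [pathComplex, graphComplex, SimpleGraph.pathGraph_adj]

theorem card_le_two_of_mem_faces {B : Finset (Fin n)} (h : B ∈ (pathComplex n).faces) :
    B.card ≤ 2 := by
  rcases mem_faces_pathComplex.1 h with ⟨i, rfl⟩ | ⟨i, j, -, rfl⟩
  · simp
  · exact Finset.card_le_two

theorem letter_mem_faces {a : ℕ} (h : (a + 1) / 2 < n) :
    (letterFace n a h).1 ∈ (pathComplex n).faces := by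
  rw [mem_faces_pathComplex]
  rcases Nat.mod_two_eq_zero_or_one a with h' | h'
  · refine Or.inl ⟨⟨(a + 1) / 2, h⟩, ?_⟩
    have : (⟨a / 2, by omega⟩ : Fin n) = ⟨(a + 1) / 2, h⟩ := Fin.ext (by simp; omega)
    simp [letterFace, this]
  · exact Or.inr ⟨_, _, Or.inl (by simp; omega), rfl⟩

theorem exists_letter_of_mem_faces {B : NodeSet n} (hB : B.1 ∈ (pathComplex n).faces) :
    ∃ a, FreeAlgebra.ι k B = letter k n a := by
  obtain ⟨B, hne⟩ := B
  rcases mem_faces_pathComplex.1 hB with ⟨i, hi⟩ | ⟨i, j, h, hi⟩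
  · simp only at hi; subst hi
    refine ⟨2 * i.1, ?_⟩
    rw [letter_eq (i := i) (j := i) (by omega) (by omega)]
    simp
  · simp only at hi; subst hi
    rcases h with h | h
    · exact ⟨2 * i.1 + 1, (letter_eq (by omega) (by omega)).symm⟩
    · refine ⟨2 * j.1 + 1, ?_⟩
      rw [letter_eq (i := j) (j := i) (by omega) (by omega)]
      congr 2; exact Finset.pair_comm _ _

theorem letterFace_injective {a b : ℕ} (ha : (a + 1) / 2 < n) (hb : (b + 1) / 2 < n)
    (h : letterFace n a ha = letterFace n b hb) : a = b := by
  have h' := congrArg Subtype.val h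
  simp only [letterFace, Finset.ext_iff, Finset.mem_insert, Finset.mem_singleton, Fin.ext_iff] at h'
  have h1 := (h' ⟨a / 2, by omega⟩).1 (Or.inl rfl)
  have h2 := (h' ⟨(a + 1) / 2, ha⟩).1 (Or.inr rfl)
  have h3 := (h' ⟨b / 2, by omega⟩).2 (Or.inl rfl)
  have h4 := (h' ⟨(b + 1) / 2, hb⟩).2 (Or.inr rfl)
  simp only at h1 h2 h3 h4
  omega

/-- Faces of the path have at most two nodes, so only the empty set and singletons contribute to the
sums over `C ⊆ A`. -/
theorem sum_powerset_of_card {α : Type*} [DecidableEq α] (f : Finset α → T)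
    (A : Finset α) (hf : ∀ C ⊆ A, 2 ≤ C.card → f C = 0) :
    ∑ C ∈ A.powerset, f C = f ∅ + ∑ a ∈ A, f {a} := by
  induction A using Finset.induction_on with
  | empty => simp
  | insert a A ha ih =>
    have h : ∑ C ∈ A.powerset, f (insert a C) = f {a} := by
      rw [Finset.sum_eq_single ∅]
      · rw [insert_empty_eq]
      · intro C hC hne
        rw [Finset.mem_powerset] at hC
        refine hf _ (Finset.insert_subset_insert _ hC) ?_
        rw [Finset.card_insert_of_notMem fun h => ha (hC h)]
        have := (Finset.nonempty_iff_ne_empty.2 hne).card_pos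
        omega
      · simp
    rw [Finset.sum_powerset_insert ha, ih fun C hC => hf C (hC.trans (Finset.subset_insert _ _)),
      Finset.sum_insert ha, h]
    abel

theorem sum_ite_of_subsingleton {α : Type*} (A : Finset α) (p : α → Prop) [DecidablePred p]
    [Decidable (∃ a ∈ A, p a)] (hp : ∀ a b, p a → p b → a = b) (c : T) :
    (∑ a ∈ A, if p a then c else 0) = if ∃ a ∈ A, p a then c else 0 := by
  split_ifs with h
  · obtain ⟨a, ha, hpa⟩ := h
    rw [Finset.sum_eq_single a, if_pos hpa]
    · intro b _ hb
      rw [if_neg fun hpb => hb (hp _ _ hpb hpa)]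
    · exact fun h => absurd ha h
  · refine Finset.sum_eq_zero fun a ha => if_neg fun hpa => h ⟨a, ha, hpa⟩

variable {τ : FreeAlgebra k (NodeSet n) →ₐ[k] T}

theorem map_freeU_empty (i : Fin n) : τ (freeU k i ∅) = τ (letter k n (2 * i.1)) := by
  rw [letter_eq (i := i) (j := i) (by omega) (by omega)]
  simp [freeU]

theorem map_freeU_singleton
    (hτ : ∀ B : NodeSet n, B.1 ∉ (pathComplex n).faces → τ (FreeAlgebra.ι k B) = 0)
    {i a : Fin n} (hia : i ≠ a) :
    τ (freeU k i {a}) = (if a.1 + 1 = i.1 then τ (letter k n (2 * i.1 - 1)) else 0) +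
      if i.1 + 1 = a.1 then τ (letter k n (2 * i.1 + 1)) else 0 := by
  split_ifs with h1 h2 h2
  · omega
  · rw [letter_eq (i := a) (j := i) (by omega) (by omega), add_zero, freeU]
    congr 3; exact Finset.pair_comm _ _
  · rw [letter_eq (i := i) (j := a) (by omega) (by omega), zero_add, freeU]
  · rw [add_zero]
    refine hτ _ fun h => ?_
    rcases mem_faces_pathComplex.1 h with ⟨j, hj⟩ | ⟨j, l, hjl, hj⟩
    · have := congrArg Finset.card hj
      simp [Finset.card_pair hia] at this
    · have h3 : i ∈ ({j, l} : Finset (Fin n)) := hj ▸ Finset.mem_insert_self _ _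
      have h4 : a ∈ ({j, l} : Finset (Fin n)) := hj ▸ by simp
      simp only [Finset.mem_insert, Finset.mem_singleton, Fin.ext_iff] at h3 h4
      have := Fin.val_ne_of_ne hia
      omega

theorem map_freeU_eq_zero
    (hτ : ∀ B : NodeSet n, B.1 ∉ (pathComplex n).faces → τ (FreeAlgebra.ι k B) = 0)
    {i : Fin n} {C : Finset (Fin n)} (hi : i ∉ C) (hC : 2 ≤ C.card) : τ (freeU k i C) = 0 := by
  refine hτ _ fun h => ?_
  have := card_le_two_of_mem_faces h
  simp only [Finset.card_insert_of_notMem hi] at this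
  omega

/-- The sum is the pseudo-root of node `i` relative to `A`: its letter plus the edges to those
neighbours that lie in `A`. -/
theorem sum_map_freeU
    (hτ : ∀ B : NodeSet n, B.1 ∉ (pathComplex n).faces → τ (FreeAlgebra.ι k B) = 0)
    {i : Fin n} {A : Finset (Fin n)} (hi : i ∉ A) :
    ∑ C ∈ A.powerset, τ (freeU k i C) =
      modified (fun a => τ (letter k n a)) (∃ a ∈ A, a.1 + 1 = i.1) (∃ a ∈ A, i.1 + 1 = a.1)
        (2 * i.1) := by
  rw [sum_powerset_of_card _ _ fun C hC => map_freeU_eq_zero hτ fun h => hi (hC h), modified,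
    map_freeU_empty, add_assoc]
  congr 1
  rw [Finset.sum_congr rfl fun a ha => map_freeU_singleton hτ (ne_of_mem_of_not_mem ha hi).symm,
    Finset.sum_add_distrib, sum_ite_of_subsingleton, sum_ite_of_subsingleton]
  · intro a b h1 h2; omega
  · intro a b h1 h2; omega

theorem sum_map_freeU_insert
    (hτ : ∀ B : NodeSet n, B.1 ∉ (pathComplex n).faces → τ (FreeAlgebra.ι k B) = 0)
    {i j : Fin n} {A : Finset (Fin n)} (hi : i ∉ A) (hj : j ∉ A) (hij : i < j) :
    ∑ E ∈ A.powerset, τ (freeU k i (insert j E)) =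
      if i.1 + 1 = j.1 then τ (letter k n (2 * i.1 + 1)) else 0 := by
  rw [Finset.sum_eq_single ∅]
  · rw [insert_empty_eq, map_freeU_singleton hτ hij.ne, if_neg (by omega), zero_add]
  · intro E hE hne
    rw [Finset.mem_powerset] at hE
    refine map_freeU_eq_zero hτ ?_ ?_
    · rw [Finset.mem_insert, not_or]; exact ⟨hij.ne, fun h => hi (hE h)⟩
    · rw [Finset.card_insert_of_notMem fun h => hj (hE h)]
      have := (Finset.nonempty_iff_ne_empty.2 hne).card_pos
      omega
  · simp

/-- The two sides of a defining relation of `Q_n`. -/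
noncomputable def defect (k : Type*) [Field k] {n : ℕ} (A : Finset (Fin n)) (i j : Fin n) :
    FreeAlgebra k (NodeSet n) :=
  (∑ C ∈ A.powerset, ∑ D ∈ A.powerset,
    (freeU k i C * freeU k j D - freeU k j D * freeU k i C)) -
    (∑ E ∈ A.powerset, freeU k i (insert j E)) * ∑ F ∈ A.powerset, (freeU k i F - freeU k j F)

/-- Allows the assumption `i < j` from here on. -/
theorem defect_swap (A : Finset (Fin n)) (i j : Fin n) : defect k A j i = - defect k A i j := by
  unfold defect
  have h : ∀ E : Finset (Fin n), freeU k j (insert i E) = freeU k i (insert j E) := by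
    intro E; unfold freeU; congr 2; exact Finset.insert_comm _ _ _
  simp only [h, Finset.sum_sub_distrib, mul_sub]
  rw [Finset.sum_comm (f := fun C D => freeU k j C * freeU k i D),
    Finset.sum_comm (f := fun C D => freeU k i D * freeU k j C)]
  abel

theorem map_defect
    (hτ : ∀ B : NodeSet n, B.1 ∉ (pathComplex n).faces → τ (FreeAlgebra.ι k B) = 0)
    {i j : Fin n} {A : Finset (Fin n)} (hi : i ∉ A) (hj : j ∉ A) (hij : i < j) :
    let g := fun a => τ (letter k n a)
    let x := modified g (∃ a ∈ A, a.1 + 1 = i.1) (∃ a ∈ A, i.1 + 1 = a.1) (2 * i.1)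
    let y := modified g (∃ a ∈ A, a.1 + 1 = j.1) (∃ a ∈ A, j.1 + 1 = a.1) (2 * j.1)
    τ (defect k A i j) = x * y - y * x -
      (if i.1 + 1 = j.1 then g (2 * i.1 + 1) else 0) * (x - y) := by
  intro g x y
  have hx : ∑ C ∈ A.powerset, τ (freeU k i C) = x := sum_map_freeU hτ hi
  have hy : ∑ C ∈ A.powerset, τ (freeU k j C) = y := sum_map_freeU hτ hj
  unfold defect
  simp only [map_sub, map_mul, map_sum, Finset.sum_sub_distrib, sum_map_freeU_insert hτ hi hj hij,
    hx, hy]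
  rw [Finset.sum_comm (f := fun C D => τ (freeU k j D) * τ (freeU k i C)), ← Finset.sum_mul_sum,
    ← Finset.sum_mul_sum, hx, hy]

theorem map_defect_mem_relSpace
    (hτ : ∀ B : NodeSet n, B.1 ∉ (pathComplex n).faces → τ (FreeAlgebra.ι k B) = 0)
    {i j : Fin n} {A : Finset (Fin n)} (hi : i ∉ A) (hj : j ∉ A) (hij : i < j) :
    τ (defect k A i j) ∈ relSpace k fun a => τ (letter k n a) := by
  rw [map_defect hτ hi hj hij]
  by_cases h : i.1 + 1 = j.1
  · rw [if_pos h]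
    have h1 : ¬ ∃ a ∈ A, i.1 + 1 = a.1 := by
      rintro ⟨a, ha, ha'⟩
      exact hj ((Fin.ext (h.symm.trans ha') : j = a) ▸ ha)
    have h2 : ¬ ∃ a ∈ A, a.1 + 1 = j.1 := by
      rintro ⟨a, ha, ha'⟩
      exact hi ((Fin.ext (by omega) : a = i) ▸ ha)
    -- With `z` the edge joining `i` and `j`, the defect `xy - yx - z(x - y)` equals `(x + z)y - (y
    -- + z)x`. Neither `x` nor `y` contains `z`, since `i` and `j` are not in `A`.
    have := modified_adjacent_mem (k := k) (g := fun a => τ (letter k n a)) (s := 2 * i.1)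
      (t := 2 * j.1) (p := ∃ a ∈ A, a.1 + 1 = i.1) (q := True) (p' := True)
      (q' := ∃ a ∈ A, j.1 + 1 = a.1) (by omega) (by rintro ⟨a, -, ha⟩; omega) (by simp) (by simp)
      (by simp)
    convert this using 1
    simp only [modified, h1, h2, if_true, if_false, show 2 * j.1 - 1 = 2 * i.1 + 1 by omega]
    noncomm_ring
  · rw [if_neg h, zero_mul, sub_zero]
    by_cases h' : i.1 + 2 = j.1
    -- The node between `i` and `j` lies in `A` or not, and so contributes its edges to both
    -- pseudo-roots or to neither.
    · refine modified_gap_mem (by omega) (by omega) (by rintro ⟨a, -, ha⟩; omega) ?_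
      refine exists_congr fun a => and_congr_right fun _ => ?_
      omega
    · have := hij
      refine modified_far_mem (by omega) (by rintro ⟨a, -, ha⟩; omega) (by simp) (by simp) (by simp)
        (by omega)

/-- Inclusion-exclusion over `A`. The facing ends of the two intervals serve as `i` and `j`; for
each interval that is an edge, the outer end is put into `A` or left out, and the difference
isolates that edge. -/
theorem rel_mem_span
    (hτ : ∀ B : NodeSet n, B.1 ∉ (pathComplex n).faces → τ (FreeAlgebra.ι k B) = 0)
    {M : Submodule k T} (hM : ∀ (A : Finset (Fin n)) (i j : Fin n), i ∉ A → j ∉ A → i ≠ j →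
      τ (defect k A i j) ∈ M) {a b : ℕ} (hab : Precedes a b) :
    rel (fun a => τ (letter k n a)) a b ∈ M := by
  by_cases hb : 2 * n - 1 ≤ b
  · rw [rel_eq_zero (n := n) (fun a ha => by simp [letter_eq_zero ha]) hab hb]
    exact M.zero_mem
  have hlt := hab
  unfold Precedes at hlt
  have hn : (b + 1) / 2 < n := by omega
  have key (A : Finset (Fin n)) (i j : Fin n) (hi : i ∉ A) (hj : j ∉ A) (hij : i < j) :=
    map_defect hτ hi hj hij ▸ hM A i j hi hj hij.ne
  have hrel : rel (fun a => τ (letter k n a)) a b = τ (letter k n a) * τ (letter k n b) -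
      τ (letter k n b) * τ (letter k n a) + if (a + 1) / 2 + 1 = b / 2 then
        (if a % 2 = 0 then τ (letter k n (a + 1)) else 0) * τ (letter k n b) -
        (if b % 2 = 0 then τ (letter k n (b - 1)) else 0) * τ (letter k n a) else 0 := by
    split_ifs with h h1 h2 h2
    all_goals first
      | rw [rel_eq_adjacent h]; simp only [*, if_true, if_false]; noncomm_ring
      | rw [rel_eq_commutator hab (Or.inl h), add_zero]
  rw [hrel]
  rcases Nat.even_or_odd' a with ⟨i, rfl | rfl⟩ <;> rcases Nat.even_or_odd' b with ⟨j, rfl | rfl⟩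
  · have hi : i < n := by omega
    have hj : j < n := by omega
    have h0 := key ∅ ⟨i, hi⟩ ⟨j, hj⟩ (by simp) (by simp) (by simp; omega)
    convert h0 using 1
    by_cases h : i + 1 = j
    · simp [modified, h, show (2 * i + 1) / 2 + 1 = j by omega,
        show 2 * j - 1 = 2 * i + 1 by omega]
      noncomm_ring
    · simp [modified, h, show ¬ (2 * i + 1) / 2 + 1 = j by omega]
  · have hi : i < n := by omega
    have hj : j < n := by omega
    have hj' : j + 1 < n := by omega
    have h0 := key ∅ ⟨i, hi⟩ ⟨j, hj⟩ (by simp) (by simp) (by simp; omega)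
    have h1 := key {⟨j + 1, hj'⟩} ⟨i, hi⟩ ⟨j, hj⟩ (by simp; omega) (by simp) (by simp; omega)
    convert sub_mem h1 h0 using 1
    by_cases h : i + 1 = j
    · simp [modified, h, show (2 * i + 1) / 2 + 1 = (2 * j + 1) / 2 by omega,
        show ¬ j + 1 + 1 = i by omega, show ¬ j + 1 + 1 = j by omega]
      noncomm_ring
    · simp [modified, h, show ¬ (2 * i + 1) / 2 + 1 = (2 * j + 1) / 2 by omega,
        show ¬ j + 1 + 1 = i by omega, show ¬ i = j by omega,
        show ¬ j + 1 + 1 = j by omega]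
      noncomm_ring
  · have hi : i < n := by omega
    have hi' : i + 1 < n := by omega
    have hj : j < n := by omega
    have h0 := key ∅ ⟨i + 1, hi'⟩ ⟨j, hj⟩ (by simp) (by simp) (by simp; omega)
    have h1 := key {⟨i, hi⟩} ⟨i + 1, hi'⟩ ⟨j, hj⟩ (by simp) (by simp; omega) (by simp; omega)
    convert sub_mem h1 h0 using 1
    by_cases h : i + 1 + 1 = j
    · simp [modified, h, show (2 * i + 1 + 1) / 2 + 1 = j by omega,
        show ¬ i + 1 = j by omega, show ¬ j + 1 = i by omega, show ¬ j = i by omega,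
        show 2 * (i + 1) - 1 = 2 * i + 1 by omega, show 2 * j - 1 = 2 * (i + 1) + 1 by omega]
      noncomm_ring
    · simp [modified, h, show ¬ (2 * i + 1 + 1) / 2 + 1 = j by omega,
        show ¬ i + 1 + 1 = i by omega, show ¬ i + 1 = j by omega, show ¬ j + 1 = i by omega,
        show 2 * (i + 1) - 1 = 2 * i + 1 by omega]
      noncomm_ring
  · have hi : i < n := by omega
    have hi' : i + 1 < n := by omega
    have hj : j < n := by omega
    have hj' : j + 1 < n := by omega
    have h0 := key ∅ ⟨i + 1, hi'⟩ ⟨j, hj⟩ (by simp) (by simp) (by simp; omega)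
    have h1 := key {⟨i, hi⟩} ⟨i + 1, hi'⟩ ⟨j, hj⟩ (by simp) (by simp; omega) (by simp; omega)
    have h2 := key {⟨j + 1, hj'⟩} ⟨i + 1, hi'⟩ ⟨j, hj⟩ (by simp; omega) (by simp) (by simp; omega)
    have h3 := key {⟨i, hi⟩, ⟨j + 1, hj'⟩} ⟨i + 1, hi'⟩ ⟨j, hj⟩
      (by simp; omega) (by simp; omega) (by simp; omega)
    -- The second difference keeps only the terms containing both outer edges; the correction `z(x -
    -- y)`, linear in each outer edge separately, cancels.
    convert add_mem (sub_mem (sub_mem h3 h2) h1) h0 using 1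
    by_cases h : i + 1 + 1 = j
    · simp [modified, h, show ¬ j = i by omega,
        show ¬ i + 1 = j by omega, show ¬ j + 1 = i by omega, show ¬ j + 1 + 1 = j by omega,
        show 2 * (i + 1) - 1 = 2 * i + 1 by omega]
      noncomm_ring
    · simp [modified, h, show ¬ i + 1 + 1 = i by omega,
        show ¬ i + 1 = j by omega, show ¬ j + 1 = i by omega, show ¬ j + 1 + 1 = j by omega,
        show 2 * (i + 1) - 1 = 2 * i + 1 by omega]
      noncomm_ring

end Relations

/-! ### Independence of letters and words, and the conclusion. -/

section Main

variable {k : Type*} [Field k] {n : ℕ} {A : Type*} [Ring A] [Algebra k A]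
  {q : FreeAlgebra k (NodeSet n) →ₐ[k] A} {V : Submodule k A}

theorem exists_defect_of_mem {z : FreeAlgebra k (NodeSet n)}
    (hz : z ∈ freeRelations k (pathComplex n)) :
    (∃ (A : Finset (Fin n)) (i j : Fin n), i ∉ A ∧ j ∉ A ∧ i ≠ j ∧ z = defect k A i j) ∨
      ∃ B : NodeSet n, B.1 ∉ (pathComplex n).faces ∧ z = FreeAlgebra.ι k B := by
  rcases hz with ⟨x, y, ⟨A, i, j, hi, hj, hij⟩, rfl⟩ | h
  · exact Or.inl ⟨A, i, j, hi, hj, hij, rfl⟩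
  · exact Or.inr h

theorem defect_mem {A : Finset (Fin n)} {i j : Fin n} (hi : i ∉ A) (hj : j ∉ A) (hij : i ≠ j) :
    defect k A i j ∈ freeRelations k (pathComplex n) :=
  Or.inl ⟨_, _, QRel.rel A i j hi hj hij, rfl⟩

/-- The relations are sums of products of generators, or generators of non-faces. Sending one letter
to `ε` with `ε² = 0` and the other generators to 0 kills them all, and so reads off one coefficient.
-/
theorem linearIndependent_letter
    (hker : TwoSidedIdeal.ker q = TwoSidedIdeal.span (freeRelations k (pathComplex n))) :
    LinearIndependent k fun a : Fin (2 * n - 1) => q (letter k n a) := by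
  classical
  have hface (a : Fin (2 * n - 1)) : (a.1 + 1) / 2 < n := by omega
  rw [Fintype.linearIndependent_iff]
  intro c hc a
  let χ : FreeAlgebra k (NodeSet n) →ₐ[k] DualNumber k := FreeAlgebra.lift k fun B =>
    if B = letterFace n a (hface a) then DualNumber.eps else 0
  have hmul (B B' : NodeSet n) : χ (FreeAlgebra.ι k B) * χ (FreeAlgebra.ι k B') = 0 := by
    simp only [χ, FreeAlgebra.lift_ι_apply]
    split_ifs <;> simp
  have hχ : TwoSidedIdeal.span (freeRelations k (pathComplex n)) ≤ TwoSidedIdeal.ker χ := by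
    refine TwoSidedIdeal.span_le.2 fun z hz => ?_
    rw [SetLike.mem_coe, TwoSidedIdeal.mem_ker]
    rcases exists_defect_of_mem hz with ⟨A, i, j, -, -, -, rfl⟩ | ⟨B, hB, rfl⟩
    · simp [defect, freeU, Finset.sum_mul_sum, mul_sub, hmul, -Finset.sum_sub_distrib]
    · rw [FreeAlgebra.lift_ι_apply, if_neg]
      rintro rfl
      exact hB (letter_mem_faces _)
  have hz : χ (∑ b, c b • letter k n b) = 0 := by
    rw [← TwoSidedIdeal.mem_ker]
    refine hχ ?_
    rw [← hker, TwoSidedIdeal.mem_ker]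
    simpa using hc
  have hl (b : Fin (2 * n - 1)) : χ (letter k n b) = if b = a then DualNumber.eps else 0 := by
    rw [letter, dif_pos (hface b), FreeAlgebra.lift_ι_apply]
    refine if_congr ⟨fun h => Fin.ext (letterFace_injective _ _ h), ?_⟩ rfl rfl
    rintro rfl; rfl
  simp only [map_sum, map_smul, hl, smul_ite, smul_zero, Finset.sum_ite_eq', Finset.mem_univ, if_true] at hz
  simpa using congrArg TrivSqZeroExt.snd hz

variable {hV : ∀ x, q (FreeAlgebra.ι k x) ∈ V}

theorem toTensor_eq_zero
    (hker : TwoSidedIdeal.ker q = TwoSidedIdeal.span (freeRelations k (pathComplex n)))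
    (B : NodeSet n) (hB : B.1 ∉ (pathComplex n).faces) :
    toTensor q V hV (FreeAlgebra.ι k B) = 0 := by
  have h : FreeAlgebra.ι k B ∈ TwoSidedIdeal.ker q := by
    rw [hker]; exact TwoSidedIdeal.subset_span (Or.inr ⟨B, hB, rfl⟩)
  rw [TwoSidedIdeal.mem_ker] at h
  simp [toTensor, h]

theorem range_ι_eq_genSpace
    (hspan : V = Submodule.span k (Set.range fun x => q (FreeAlgebra.ι k x)))
    (hker : TwoSidedIdeal.ker q = TwoSidedIdeal.span (freeRelations k (pathComplex n))) :
    LinearMap.range (TensorAlgebra.ι k (M := V)) =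
      genSpace k fun a => toTensor q V hV (letter k n a) := by
  rw [range_ι_eq_span (hV := hV) hspan]
  refine le_antisymm (Submodule.span_le.2 ?_) (Submodule.span_le.2 ?_)
  · rintro _ ⟨B, rfl⟩
    by_cases hB : B.1 ∈ (pathComplex n).faces
    · obtain ⟨a, ha⟩ := exists_letter_of_mem_faces (k := k) hB
      simp only [ha]
      exact gen_mem (g := fun a => toTensor q V hV (letter k n a)) a
    · simp only [toTensor_eq_zero hker B hB]
      exact Submodule.zero_mem _
  · rintro _ ⟨a, rfl⟩
    simp only [letter]
    split_ifs with h
    · exact Submodule.subset_span ⟨_, rfl⟩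
    · rw [map_zero]; exact Submodule.zero_mem _

theorem span_image_eq_relSpace
    (hker : TwoSidedIdeal.ker q = TwoSidedIdeal.span (freeRelations k (pathComplex n))) :
    Submodule.span k (toTensor q V hV '' freeRelations k (pathComplex n)) =
      relSpace k fun a => toTensor q V hV (letter k n a) := by
  have hτ := toTensor_eq_zero (hV := hV) hker
  refine le_antisymm (Submodule.span_le.2 ?_) (Submodule.span_le.2 ?_)
  · rintro _ ⟨z, hz, rfl⟩
    rcases exists_defect_of_mem hz with ⟨A, i, j, hi, hj, hij, rfl⟩ | ⟨B, hB, rfl⟩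
    · rcases lt_or_gt_of_ne hij with h | h
      · exact map_defect_mem_relSpace hτ hi hj h
      · rw [defect_swap, map_neg]
        exact Submodule.neg_mem _ (map_defect_mem_relSpace hτ hj hi h)
    · rw [hτ B hB]
      exact Submodule.zero_mem _
  · rintro _ ⟨a, b, hab, rfl⟩
    exact rel_mem_span hτ (fun A i j hi hj hij =>
      Submodule.subset_span (Set.mem_image_of_mem _ (defect_mem hi hj hij))) hab

theorem relSpace_le {T : Type*} [Ring T] [Algebra k T] (g : ℕ → T) :
    relSpace k g ≤ genSpace k g ^ 2 := by
  refine Submodule.span_le.2 ?_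
  rintro _ ⟨a, b, -, rfl⟩
  rw [SetLike.mem_coe, sq]
  exact sub_mem (Submodule.mul_mem_mul (pseudoRoot_mem _ _) (gen_mem _))
    (Submodule.mul_mem_mul (pseudoRoot_mem _ _) (gen_mem _))

/-- The letters in range form a basis of `V`, so these words are part of the monomial basis of
`T(V)`. -/
theorem linearIndependent_word
    (hspan : V = Submodule.span k (Set.range fun x => q (FreeAlgebra.ι k x)))
    (hker : TwoSidedIdeal.ker q = TwoSidedIdeal.span (freeRelations k (pathComplex n))) (m : ℕ) :
    LinearIndependent k fun x : WordIndex n m =>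
      word (fun a => toTensor q V hV (letter k n a)) x.1 := by
  have hmem (a : ℕ) : q (letter k n a) ∈ V := by
    unfold letter
    split_ifs
    · exact hV _
    · rw [map_zero]; exact V.zero_mem
  let v : Fin (2 * n - 1) → V := fun a => ⟨q (letter k n a), hmem a⟩
  have hι (a : ℕ) : TensorAlgebra.ι k (⟨q (letter k n a), hmem a⟩ : V) =
      toTensor q V hV (letter k n a) := by
    by_cases h : (a + 1) / 2 < n
    · simp [letter, h, toTensor]
    · have : (⟨q (letter k n a), hmem a⟩ : V) = 0 := by ext; simp [letter, h]
      rw [this]; simp [letter, h]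
  have hli : LinearIndependent k v :=
    LinearIndependent.of_comp V.subtype (linearIndependent_letter hker)
  have htop : ⊤ ≤ Submodule.span k (Set.range v) := by
    rw [← span_range_mk_eq_top (hV := hV) hspan]
    refine Submodule.span_le.2 ?_
    rintro _ ⟨B, rfl⟩
    by_cases hB : B.1 ∈ (pathComplex n).faces
    · obtain ⟨a, ha⟩ := exists_letter_of_mem_faces (k := k) hB
      by_cases ha' : a < 2 * n - 1
      · exact Submodule.subset_span ⟨⟨a, ha'⟩, by simp [v, ha]⟩
      · have : (⟨q (FreeAlgebra.ι k B), hV B⟩ : V) = 0 := by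
          ext; simp [ha, letter_eq_zero (not_lt.1 ha')]
        simp only [this]
        exact Submodule.zero_mem _
    · have hz := toTensor_eq_zero (hV := hV) hker B hB
      have : (⟨q (FreeAlgebra.ι k B), hV B⟩ : V) = 0 := by
        rw [toTensor, FreeAlgebra.lift_ι_apply, TensorAlgebra.ι_eq_zero_iff] at hz
        exact hz
      simp only [this]
      exact Submodule.zero_mem _
  let b : Module.Basis (Fin (2 * n - 1)) k V := Module.Basis.mk hli htop
  have hb (l : List (Fin (2 * n - 1))) : b.tensorAlgebra (FreeMonoid.ofList l) =
      word (fun a => toTensor q V hV (letter k n a)) (l.map Fin.val) := by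
    have h (l : List (Fin (2 * n - 1))) : FreeAlgebra.basisFreeMonoid k _ (FreeMonoid.ofList l) =
        (l.map (FreeAlgebra.ι k)).prod := by
      simp [FreeAlgebra.basisFreeMonoid, FreeAlgebra.equivMonoidAlgebraFreeMonoid,
        FreeMonoid.lift_ofList]
    rw [Module.Basis.tensorAlgebra, Module.Basis.map_apply, h]
    simp only [AlgEquiv.toLinearEquiv_apply, map_list_prod, List.map_map, word]
    congr 2
    funext a
    simp [b, v, hι]
  let φ : WordIndex n m → FreeMonoid (Fin (2 * n - 1)) := fun x =>
    FreeMonoid.ofList (x.1.attach.map fun a => ⟨a.1, x.2.2 a.1 a.2⟩)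
  have hφ (x : WordIndex n m) :
      (x.1.attach.map fun a => (⟨a.1, x.2.2 a.1 a.2⟩ : Fin (2 * n - 1))).map Fin.val = x.1 := by
    simp [List.map_map, Function.comp_def]
  have hinj : Function.Injective φ := by
    intro x y hxy
    refine Subtype.ext ?_
    rw [← hφ x, ← hφ y]
    exact congrArg (fun l : List (Fin (2 * n - 1)) => l.map Fin.val)
      (FreeMonoid.ofList.injective hxy)
  have hcomp : (fun x : WordIndex n m => word (fun a => toTensor q V hV (letter k n a)) x.1) =
      b.tensorAlgebra ∘ φ := by
    funext x
    rw [Function.comp_apply, hb, hφ]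
  rw [hcomp]
  exact b.tensorAlgebra.linearIndependent.comp φ hinj

theorem isKoszulAlgebra_of_presentation (hq : Function.Surjective q)
    (hspan : V = Submodule.span k (Set.range fun x => q (FreeAlgebra.ι k x)))
    (hker : TwoSidedIdeal.ker q = TwoSidedIdeal.span (freeRelations k (pathComplex n))) :
    IsKoszulAlgebra V := by
  have hV : ∀ x, q (FreeAlgebra.ι k x) ∈ V := fun x => hspan ▸ Submodule.subset_span ⟨x, rfl⟩
  have hrange := range_ι_eq_genSpace (hV := hV) hspan hker
  have hrel := span_image_eq_relSpace (hV := hV) hker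
  have hquad : toTensor q V hV '' freeRelations k (pathComplex n) ⊆
      (tensorPiece V 2 : Set (TensorAlgebra k V)) := by
    rw [← Submodule.span_le, hrel, tensorPiece, hrange]
    exact relSpace_le _
  refine ⟨isQuadraticAlgebra hq hspan hker hquad, fun m => ?_⟩
  obtain ⟨e, he, hs⟩ := exists_distributing_family
    (g := fun a => toTensor q V hV (letter k n a))
    (fun a ha => by rw [letter_eq_zero ha, map_zero]) m
    (linearIndependent_word (hV := hV) hspan hker m)
  refine generatesDistributive_of_linearIndependent he ?_
  rintro _ ⟨a, b, hab, rfl⟩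
  obtain ⟨s, hs⟩ := hs a b hab
  refine ⟨s, ?_⟩
  rw [tensorPiece, tensorPiece, quadRelations_eq hspan hker hquad, hrel, hrange, hs]

end Main

end PathKoszul

theorem mainTheorem1 (k : Type*) [Field k] (n : ℕ) :
    IsKoszulAlgebra (A := QComplex k (pathComplex n))
      (QComplex.generatorSpan k (pathComplex n)) :=
  PathKoszul.isKoszulAlgebra_of_presentation
    (PathKoszul.presentation_surjective k (pathComplex n)) rfl
    (PathKoszul.ker_presentation k (pathComplex n))
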